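/- **Setting.** A labeled loop with $P\ge 1$ points is a permutation $\sigma\in\mathbb S_P$ that is a single cycle through all of $1,\dots,P$. Write $\rho\circ\sigma:=\rho\sigma\rho^{-1}$, let $\tau_j$ be the transposition of $j$ and $j+1$, and let $\sigma_j^-$, $\sigma_j^+$ be the two cycles of $\tau_j\sigma$ containing $j$ and $j+1$ respectively. They are regarded as labeled loops on fewer points after the order-preserving relabeling of their points, and $[\sigma_j^\pm](x)$ is evaluated at the positions of these points. Write $\nabla_j=\partial/\partial x_j$. Let $\sigma\mapsto[\sigma](x_1,\dots,x_P)$ be a family of real polynomials indexed by labeled loops such that one of the following holds. (A) The family solves the (local) stationarity conditions with $\Delta n=1$: each $[\sigma]$ has degree at most one in each variable; $\nabla_1[(1)]=1$ for the loop with one point; for $P\ge2$, $[\sigma]|_{x_1=0}=0$ and $[\sigma]|_{x_P=1}=0$; and for $1\le j<P$ $$[\sigma]|_{x_j=x_{j+1}}=[\tau_j\circ\sigma]|_{x_j=x_{j+1}},\qquad (\nabla_j-\nabla_{j+1})\big([\sigma]+[\tau_j\circ\sigma]\big)\big|_{x_j=x_{j+1}}=2\,\nabla_j[\sigma_j^-]\,\nabla_{j+1}[\sigma_j^+].$$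 (B) The family is given by the explicit recursion on $P$: $[(1)](x)=a+x$ for some $a\in\mathbb R$ and, for $P\ge2$, $$[\sigma]=\sum_{j=1}^{P-2}x_1\cdots x_j\,[\sigma]^o_{j+1}+x_1\cdots x_{P-1}(1-x_P)\,[\sigma]^o_P,\qquad [\sigma]^o_{j+1}=\nabla_{j+1}\cdots\nabla_1\sum_{l=1}^{j}\big[(\tau_{l+1}\cdots\tau_j\circ\sigma)^-_l\big]\big[(\tau_{l+1}\cdots\tau_j\circ\sigma)^+_l\big].$$ Let $\omega_P=(1\,2\cdots P)$. Let $\mu\in\mathbb S_m$, $m=|\mu|$, be a deformation profile and, for $n\ge1$ and $n+m-1\le P$, let $\mu_n\in\mathbb S_P$ be its translate: $\mu_n(i+n-1)=\mu(i)+n-1$ for $1\le i\le m$, and $\mu_n$ fixes all other points. With $P$ the number of points of the loop, put $y_l=x_{P-l}$, and for $k\ge0$ set $$C^{\mu_n}_{N+k+1;k}=\nabla_{N+1}\cdots\nabla_1[\mu_n\circ\omega_{N+k+1}],\qquad S^{\mu_n}_{N+k+2;k}=\nabla_{N+1}\cdots\nabla_1[\mu_n\circ\omega_{N+k+2}]\big|_{x_{N+2}=0},$$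 $$\mathcal D_k^{(\mu;q)}(z)=\sum_{N\ge0}C^{\mu_{q+N}}_{N+k+1;k}\,z^N,\qquad \mathcal S_k^{(\mu;q)}(z)=\sum_{N\ge0}S^{\mu_{q+N+1}}_{N+k+2;k}\,z^N ,$$ which are formal power series in $z$ with coefficients polynomial in $y_0,y_1,\dots$. For $q\ge1$ they make sense when $q+|\mu|\le k+2$, i.e. when the deformation lies within the chain. Let $\mathfrak c(z)=\frac{\sqrt{1+4z}-1}{2z}=\sum_{N\ge0}(-1)^N\mathrm{Cat}_N\,z^N$, with $\mathrm{Cat}_N$ the Catalan numbers, and let $[\cdots]_+$ denote the part of nonnegative degree in $z$ of a Laurent series. **Proposition.** For every profile $\mu$: 1. for all $q\ge2$ and $k\ge0$ with $q+|\mu|\le k+3$, $$\mathcal D_{k+1}^{(\mu;q)}(z)=\mathcal S_k^{(\mu;q-1)}(z)+y_k z^{-1}\big(\mathcal D_k^{(\mu;q-1)}(z)-\mathcal D_k^{(\mu;q-1)}(0)\big);$$ 2. for all $q\ge2$ and $k\ge0$ with $q+|\mu|\le k+2$, $$\mathcal S_k^{(\mu;q)}(z)=\mathfrak c(z)\,\mathcal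 D_k^{(\mu;q)}(z);$$ 3. for all $q\ge3$ and $k\ge0$ with $q+|\mu|\le k+3$, $$\mathcal D_{k+1}^{(\mu;q)}(z)=\Big[\big(\mathfrak c(z)+\tfrac{y_k}{z}\big)\mathcal D_k^{(\mu;q-1)}(z)\Big]_+;$$ 4. given relation 1 at $(q,k)$, relation 2 at $(q-1,k)$ and relation 3 at $(q,k)$ are equivalent: for all formal power series $A,D,S$ in $z$ with coefficients in $\mathbb R[y_0,y_1,\dots]$ and every $y\in\mathbb R[y_0,y_1,\dots]$ with $A=S+y z^{-1}(D-D(0))$, one has $S=\mathfrak c D$ if and only if $A=[(\mathfrak c+y/z)D]_+$. -/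

import Mathlib

noncomputable section

namespace QSSEP

open MvPolynomial

/-- Polynomials over `ℝ` in countably many variables. They are used for polynomials in the
positions (`X i` is then the position of the point with label `i`; labels start at `0`, so that
`X i` is `x_{i+1}` when the points are numbered from `1`), and for polynomials in the floating
variables (`X l` is then `y_l`). -/
abbrev Poly : Type := MvPolynomial ℕ ℝ

/-- A family of polynomials `[σ]`, one for each number of points `P` and each permutation `σ` of
the `P` points. Only the values at labeled loops (single cycles through all `P` points) matter. -/
abbrev LoopFamily : Type := (P : ℕ) → Equiv.Perm (Fin P) → Poly

/-- `σ` is a labeled loop: a single cycle through all `P` points. -/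
def IsLoop {P : ℕ} (σ : Equiv.Perm (Fin P)) : Prop := σ.IsCycleOn Set.univ

/-- The transposition of the neighbouring labels `j` and `j + 1` (it is only used for
`j + 1 < P`). -/
def tau (P j : ℕ) : Equiv.Perm (Fin P) :=
  if h : j + 1 < P then Equiv.swap ⟨j, by omega⟩ ⟨j + 1, h⟩ else 1

/-- The adjoint action `ρ ∘ σ := ρ σ ρ⁻¹`. -/
def conj {P : ℕ} (ρ σ : Equiv.Perm (Fin P)) : Equiv.Perm (Fin P) := ρ * σ * ρ⁻¹

/-- The points of the cycle of `π` that contains `a`. -/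
def cyclePoints {P : ℕ} (π : Equiv.Perm (Fin P)) (a : Fin P) : Finset (Fin P) := by
  classical exact Finset.univ.filter fun i => π.SameCycle a i

theorem mem_cyclePoints {P : ℕ} (π : Equiv.Perm (Fin P)) (a i : Fin P) :
    i ∈ cyclePoints π a ↔ π.SameCycle a i := by
  simp [cyclePoints]

theorem apply_mem_cyclePoints {P : ℕ} (π : Equiv.Perm (Fin P)) (a i : Fin P) :
    π i ∈ cyclePoints π a ↔ i ∈ cyclePoints π a := by
  simp [mem_cyclePoints]

/-- The cycle of `π` through `a`, as a permutation of `0, …, p - 1` with `p` its number of points,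
after the order preserving relabeling of its points. -/
def cyclePerm {P : ℕ} (π : Equiv.Perm (Fin P)) (a : Fin P) :
    Equiv.Perm (Fin (cyclePoints π a).card) :=
  ((cyclePoints π a).orderIsoOfFin rfl).toEquiv.symm.permCongr
    (π.subtypePerm (apply_mem_cyclePoints π a))

/-- The polynomial attached by the family `F` to the cycle of `π` through the label `a`, viewed as
a labeled loop with fewer points; it is a polynomial in the positions of the points of that
cycle. (It is only used for `a < P`.) -/
def subLoop (F : LoopFamily) {P : ℕ} (π : Equiv.Perm (Fin P)) (a : ℕ) : Poly :=
  if h : a < P then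
    aeval (fun i : ℕ =>
      if hi : i < (cyclePoints π ⟨a, h⟩).card then
        (X (((cyclePoints π ⟨a, h⟩).orderEmbOfFin rfl ⟨i, hi⟩ : Fin P) : ℕ) : Poly)
      else 0)
      (F _ (cyclePerm π ⟨a, h⟩))
  else 0

/-- `[σ_j⁻]`: the cycle of `τ_j σ` through `j`. -/
def minusLoop (F : LoopFamily) {P : ℕ} (σ : Equiv.Perm (Fin P)) (j : ℕ) : Poly :=
  subLoop F (tau P j * σ) j

/-- `[σ_j⁺]`: the cycle of `τ_j σ` through `j + 1`. -/
def plusLoop (F : LoopFamily) {P : ℕ} (σ : Equiv.Perm (Fin P)) (j : ℕ) : Poly :=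
  subLoop F (tau P j * σ) (j + 1)

/-- Evaluation of the variable `X i` at the real number `c`. -/
def evalVar (i : ℕ) (c : ℝ) : Poly →ₐ[ℝ] Poly := aeval (Function.update X i (C c))

/-- The restriction `x_{j+1} = x_j`. -/
def diagVar (j : ℕ) : Poly →ₐ[ℝ] Poly := aeval (Function.update X (j + 1) (X j))

/-- `∇_{k-1} ⋯ ∇_0 f`: the derivative with respect to the positions of the first `k` points. -/
def nablas : ℕ → Poly → Poly
  | 0, f => f
  | k + 1, f => pderiv k (nablas k f)

/-- The stationarity conditions, in local form, for a family of polynomials indexed by labeled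
loops, normalized by `Δn = 1`. -/
structure IsStationary (F : LoopFamily) : Prop where
  /-- `[σ]` is a polynomial in the positions of the `P` points -/
  vars_subset : ∀ (P : ℕ) (σ : Equiv.Perm (Fin P)), IsLoop σ → (F P σ).vars ⊆ Finset.range P
  /-- locality: `[σ]` is harmonic, hence affine, in each position separately -/
  degreeOf_le : ∀ (P : ℕ) (σ : Equiv.Perm (Fin P)), IsLoop σ →
    ∀ i, (F P σ).degreeOf i ≤ 1
  /-- the loop with one point has slope `Δn = 1` -/
  one_point : pderiv 0 (F 1 1) = 1
  /-- boundary condition at the left end of the chain -/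
  left_bdry : ∀ (P : ℕ) (σ : Equiv.Perm (Fin P)), IsLoop σ → 2 ≤ P →
    evalVar 0 0 (F P σ) = 0
  /-- boundary condition at the right end of the chain -/
  right_bdry : ∀ (P : ℕ) (σ : Equiv.Perm (Fin P)), IsLoop σ → 2 ≤ P →
    evalVar (P - 1) 1 (F P σ) = 0
  /-- first exchange relation: continuity -/
  continuity : ∀ (P : ℕ) (σ : Equiv.Perm (Fin P)), IsLoop σ → ∀ j, j + 1 < P →
    diagVar j (F P σ) = diagVar j (F P (conj (tau P j) σ))
  /-- second exchange relation: gluing -/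
  gluing : ∀ (P : ℕ) (σ : Equiv.Perm (Fin P)), IsLoop σ → ∀ j, j + 1 < P →
    diagVar j (pderiv j (F P σ + F P (conj (tau P j) σ))
        - pderiv (j + 1) (F P σ + F P (conj (tau P j) σ)))
      = 2 * (pderiv j (minusLoop F σ j) * pderiv (j + 1) (plusLoop F σ j))

/-- The product `τ_{k+1} τ_{k+2} ⋯ τ_{j-1}` of transpositions of neighbouring labels (an empty
product is `1`). -/
def slide (P k j : ℕ) : Equiv.Perm (Fin P) := ((List.Ico (k + 1) j).map (tau P)).prod

/-- The right-hand side of the explicit formula for the hole coefficient of `[σ]` with its hole at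
the label `j` (that is, at the point number `j + 1`), in terms of loops with fewer points:
`∇_j ⋯ ∇_0 ∑_{k<j} [(τ_{k+1} ⋯ τ_{j-1} ∘ σ)_k⁻] [(τ_{k+1} ⋯ τ_{j-1} ∘ σ)_k⁺]`. -/
def holeFormula (F : LoopFamily) {P : ℕ} (σ : Equiv.Perm (Fin P)) (j : ℕ) : Poly :=
  nablas (j + 1) (∑ k ∈ Finset.range j,
    minusLoop F (conj (slide P k j) σ) k * plusLoop F (conj (slide P k j) σ) k)

/-- The explicit family of loop polynomials, defined by recursion on the number of points `P`:
`[(1)] = a + x` for one point, and otherwise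
`∑_{j=1}^{P-2} x_0 ⋯ x_{j-1} h_j + x_0 ⋯ x_{P-2} (1 - x_{P-1}) h_{P-1}`
with `h_j` given by `holeFormula`, which only involves loops with fewer points. -/
def explicitLoop (a : ℝ) (P : ℕ) (σ : Equiv.Perm (Fin P)) : Poly :=
  if P = 1 then C a + X 0
  else
    let G : LoopFamily := fun Q ρ => if _h : Q < P then explicitLoop a Q ρ else 0
    (∑ j ∈ Finset.Ico 1 (P - 1), (∏ i ∈ Finset.range j, X i) * holeFormula G σ j)
      + (∏ i ∈ Finset.range (P - 1), X i) * (1 - X (P - 1)) * holeFormula G σ (P - 1)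
termination_by P

/-- The deformation `μ_n` with profile `μ`, as a permutation of `P` points. With the points
numbered from `1` (and `n ≥ 1`), its support is contained in `[n, n + m - 1]` and
`μ_n(i + n - 1) = μ(i) + n - 1` for `1 ≤ i ≤ m`. It makes sense if `n + m - 1 ≤ P`. -/
def deformation {m : ℕ} (μ : Equiv.Perm (Fin m)) (n P : ℕ) : Equiv.Perm (Fin P) :=
  if h : n - 1 + m ≤ P then
    μ.viaEmbedding ⟨fun i => ⟨n - 1 + i, by omega⟩, fun i i' hi => by
      simp only [Fin.mk.injEq] at hi; exact Fin.ext (by omega)⟩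
  else 1

/-- The deformed regular loop `μ_n ∘ ω_P`, with `ω_P = (1 2 ⋯ P)`. -/
def deformedLoop {m : ℕ} (μ : Equiv.Perm (Fin m)) (n P : ℕ) : Equiv.Perm (Fin P) :=
  conj (deformation μ n P) (finRotate P)

/-- Passage to the floating variables `y_l = x_{P-l}` (points numbered from `1`). -/
def toFloating (P : ℕ) : Poly →ₐ[ℝ] Poly := rename fun i => P - 1 - i

/-- The multiple derivative
`C^{μ_n}_{N+k+1;k} = ∇_1 ⋯ ∇_{N+1} [μ_n ∘ ω_{N+k+1}]` (points numbered from `1`). -/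
def coeffC (F : LoopFamily) {m : ℕ} (μ : Equiv.Perm (Fin m)) (n N k : ℕ) : Poly :=
  toFloating (N + k + 1) (nablas (N + 1) (F (N + k + 1) (deformedLoop μ n (N + k + 1))))

/-- The hole coefficient
`S^{μ_n}_{N+k+2;k} = ∇_1 ⋯ ∇_{N+1} [μ_n ∘ ω_{N+k+2}]` at `x_{N+2} = 0` (points numbered
from `1`, so that `x_{N+2}` is the variable `X (N + 1)`). -/
def coeffS (F : LoopFamily) {m : ℕ} (μ : Equiv.Perm (Fin m)) (n N k : ℕ) : Poly :=
  toFloating (N + k + 2)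
    (evalVar (N + 1) 0 (nablas (N + 1) (F (N + k + 2) (deformedLoop μ n (N + k + 2)))))

/-- `D_k^{(μ;q)}(z) = ∑_N C^{μ_{q+N}}_{N+k+1;k} z^N`. -/
def seriesD (F : LoopFamily) {m : ℕ} (μ : Equiv.Perm (Fin m)) (q k : ℕ) : PowerSeries Poly :=
  PowerSeries.mk fun N => coeffC F μ (q + N) N k

/-- `S_k^{(μ;q)}(z) = ∑_N S^{μ_{q+N+1}}_{N+k+2;k} z^N`. -/
def seriesS (F : LoopFamily) {m : ℕ} (μ : Equiv.Perm (Fin m)) (q k : ℕ) : PowerSeries Poly :=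
  PowerSeries.mk fun N => coeffS F μ (q + N + 1) N k

/-- `c(z) = (√(1+4z) - 1) / 2z = 1 - z + 2 z² - 5 z³ + ⋯`, the generating function of the
alternating Catalan numbers. -/
def altCatalan : PowerSeries Poly :=
  PowerSeries.mk fun N => (-1) ^ N * (catalan N : Poly)

/-- `c(z)` solves `z c² + c - 1 = 0`. -/
theorem X_mul_altCatalan_sq_add :
    PowerSeries.X * altCatalan ^ 2 + altCatalan = (1 : PowerSeries Poly) := by
  ext1 n
  cases n with
  | zero => simp [altCatalan]
  | succ n =>
    rw [map_add, PowerSeries.coeff_succ_X_mul, sq, PowerSeries.coeff_mul]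
    simp only [altCatalan, PowerSeries.coeff_mk]
    rw [catalan_succ', PowerSeries.coeff_one]
    push_cast
    rw [Finset.mul_sum, ← Finset.sum_add_distrib]
    apply Finset.sum_eq_zero
    intro x hx
    rw [← Finset.HasAntidiagonal.mem_antidiagonal.1 hx]
    ring

/-- `z⁻¹ (f(z) - f(0))`. -/
def divZ (f : PowerSeries Poly) : PowerSeries Poly :=
  PowerSeries.mk fun N => PowerSeries.coeff (N + 1) f

theorem X_mul_divZ (f : PowerSeries Poly) :
    PowerSeries.X * divZ f = f - PowerSeries.C (PowerSeries.constantCoeff f) :=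
  (PowerSeries.sub_const_eq_X_mul_shift f).symm

/-- `[(c(z) + y z⁻¹) f(z)]_+`: the part of nonnegative degree of the product, computed in Laurent
series. -/
def plusPart (y : Poly) (f : PowerSeries Poly) : PowerSeries Poly :=
  PowerSeries.mk fun N =>
    ((HahnSeries.ofPowerSeries ℤ Poly altCatalan + HahnSeries.single (-1 : ℤ) y)
      * HahnSeries.ofPowerSeries ℤ Poly f).coeff (N : ℤ)

end QSSEP

end

noncomputable section

namespace QSSEP

open MvPolynomial

/-! ### Calculus of polynomials that are affine in each variable -/

/-! Both alternatives for the family enter only through `HasHoleFormula`: the loop polynomials are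
affine in each position, the one-point loop has slope one, the hole coefficient at label `j`
(derivatives in the positions before `j`, then position `j` set to zero) is `holeFormula`, and the
full derivative is minus the hole coefficient at the last label. For a stationary family, `exchange`
moves a hole one label to the left at the cost of a product of two shorter loops, until it vanishes
at the left boundary (`IsStationary.hole`). For the explicit family the hole coefficients are read
off, since exactly one summand survives (`hasHoleFormula_explicitLoop`).

Relation 1 is then affinity in the single variable `y_k`: a polynomial is its value at zero plus the
variable times its derivative (`coeffC_succ`).

Relation 2 evaluates `holeFormula` on a deformed regular loop. Because `q ≥ 2`, the deformation lies
strictly to the right of the hole, so it commutes with all the transpositions involved. Each cut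
therefore splits off an undeformed regular loop and leaves a regular loop with the same profile,
translated (`minusLoop_slide_deformedLoop`, `plusLoop_slide_deformedLoop`). All variables of the
regular factor are differentiated, which makes it a constant, and in floating variables the other
factor is a coefficient of `seriesD`. The hole coefficient is thus a convolution
(`toFloating_holeFormula_deformedLoop`). Applied to the empty profile, the same identity is the
Catalan recursion up to sign, so the constants are the coefficients of `altCatalan`
(`regularCoeff_eq`).

Relations 3 and 4 are formal once the nonnegative part is split into its two contributions
(`plusPart_eq`). -/

theorem pderiv_comm (i j : ℕ) (f : Poly) : pderiv i (pderiv j f) = pderiv j (pderiv i f) := by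
  ext m
  rcases eq_or_ne i j with rfl | h
  · rfl
  · simp only [coeff_pderiv, Finsupp.add_apply, Finsupp.single_apply, h, h.symm, if_false,
      add_zero]
    rw [add_right_comm]
    ring

/-- Characteristic zero is essential: the exponent that appears as a factor must be invertible. -/
theorem notMem_vars_of_pderiv_eq_zero {i : ℕ} {f : Poly} (h : pderiv i f = 0) : i ∉ f.vars := by
  rw [mem_vars_iff_mem_support]
  rintro ⟨d, hd, hi⟩
  have hle : Finsupp.single i 1 ≤ d := by
    rw [Finsupp.single_le_iff]
    exact Nat.one_le_iff_ne_zero.2 (Finsupp.mem_support_iff.1 hi)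
  have := coeff_pderiv (i := i) f (d - Finsupp.single i 1)
  rw [h, coeff_zero, tsub_add_cancel_of_le hle] at this
  rcases mul_eq_zero.1 this.symm with h1 | h1
  · exact (mem_support_iff.1 hd) h1
  · exact absurd h1 (by positivity)

/-- `f` is affine in each variable separately. -/
def IsMultiaffine (f : Poly) : Prop := ∀ i, pderiv i (pderiv i f) = 0

theorem isMultiaffine_of_degreeOf_le {f : Poly} (h : ∀ i, f.degreeOf i ≤ 1) :
    IsMultiaffine f := by
  intro i
  ext m
  rw [coeff_pderiv, coeff_pderiv, coeff_zero, add_assoc, ← Finsupp.single_add]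
  have : coeff (m + Finsupp.single i (1 + 1)) f = 0 := by
    by_contra hne
    have h1 := (degreeOf_le_iff.1 (h i)) _ (mem_support_iff.2 hne)
    simp at h1
  rw [this]; ring

namespace IsMultiaffine

theorem one : IsMultiaffine 1 := fun i => by simp

theorem C (a : ℝ) : IsMultiaffine (C a) := fun i => by simp

theorem X (n : ℕ) : IsMultiaffine (X n) := fun i => by
  rcases eq_or_ne n i with rfl | h
  · simp
  · rw [pderiv_X_of_ne h, map_zero]

theorem add {f g : Poly} (hf : IsMultiaffine f) (hg : IsMultiaffine g) :
    IsMultiaffine (f + g) := fun i => by simp [hf i, hg i]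

theorem sub {f g : Poly} (hf : IsMultiaffine f) (hg : IsMultiaffine g) :
    IsMultiaffine (f - g) := fun i => by simp [hf i, hg i]

theorem sum {ι : Type*} {s : Finset ι} {f : ι → Poly} (h : ∀ i ∈ s, IsMultiaffine (f i)) :
    IsMultiaffine (∑ i ∈ s, f i) := fun i => by
  rw [map_sum, map_sum]
  exact Finset.sum_eq_zero fun j hj => h j hj i

theorem mul {f g : Poly} (hf : IsMultiaffine f) (hg : IsMultiaffine g)
    (h : ∀ i, pderiv i f = 0 ∨ pderiv i g = 0) : IsMultiaffine (f * g) := fun i => by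
  rcases h i with h | h
  · simp [h, hg i]
  · simp [h, hf i]

theorem pderiv {f : Poly} (hf : IsMultiaffine f) (j : ℕ) : IsMultiaffine (pderiv j f) :=
  fun i => by rw [pderiv_comm i j, pderiv_comm i j, hf i, map_zero]

theorem nablas {f : Poly} (hf : IsMultiaffine f) (n : ℕ) : IsMultiaffine (nablas n f) := by
  induction n with
  | zero => exact hf
  | succ n ih => exact ih.pderiv n

end IsMultiaffine

/-! ### Evaluation of a variable -/

@[simp] theorem evalVar_X_self (i : ℕ) (c : ℝ) : evalVar i c (X i) = C c := by
  simp [evalVar]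

theorem evalVar_X_of_ne {i j : ℕ} (h : j ≠ i) (c : ℝ) : evalVar i c (X j) = X j := by
  simp [evalVar, h]

theorem aeval_eq_self_of_eqOn_vars {φ : ℕ → Poly} {f : Poly} (h : ∀ i ∈ f.vars, φ i = X i) :
    aeval φ f = f := by
  have : aeval φ f = aeval X f :=
    eval₂Hom_congr' rfl (fun i hi _ => h i hi) rfl
  rw [this, aeval_X_left_apply]

theorem evalVar_of_pderiv_eq_zero {i : ℕ} {f : Poly} (h : pderiv i f = 0) (c : ℝ) :
    evalVar i c f = f :=
  aeval_eq_self_of_eqOn_vars fun j hj => by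
    rw [Function.update_of_ne]
    rintro rfl
    exact notMem_vars_of_pderiv_eq_zero h hj

theorem pderiv_evalVar_self (i : ℕ) (c : ℝ) (f : Poly) : pderiv i (evalVar i c f) = 0 := by
  induction f using MvPolynomial.induction_on with
  | C a => simp [evalVar]
  | add p q hp hq => simp [hp, hq]
  | mul_X p n h =>
    rw [map_mul, pderiv_mul, h]
    rcases eq_or_ne n i with rfl | hn
    · simp
    · simp [evalVar_X_of_ne hn, pderiv_X_of_ne hn]

theorem pderiv_evalVar_of_ne {i j : ℕ} (hij : i ≠ j) (c : ℝ) (f : Poly) :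
    pderiv i (evalVar j c f) = evalVar j c (pderiv i f) := by
  induction f using MvPolynomial.induction_on with
  | C a => simp [evalVar]
  | add p q hp hq => simp [hp, hq]
  | mul_X p n h =>
    rw [map_mul, pderiv_mul, h, pderiv_mul, map_add, map_mul, map_mul]
    congr 2
    rcases eq_or_ne n j with rfl | hn
    · simp [pderiv_X_of_ne hij.symm]
    · rw [evalVar_X_of_ne hn]
      rcases eq_or_ne n i with rfl | hi
      · simp
      · simp [pderiv_X_of_ne hi]

theorem nablas_evalVar {n j : ℕ} (h : n ≤ j) (c : ℝ) (f : Poly) :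
    nablas n (evalVar j c f) = evalVar j c (nablas n f) := by
  induction n with
  | zero => rfl
  | succ n ih =>
    rw [nablas, ih (by omega), pderiv_evalVar_of_ne (by omega), nablas]

/-- The difference of the two sides does not depend on the variable, so it equals its own value at
zero, which is zero. -/
theorem eq_evalVar_add_of_pderiv_pderiv {i : ℕ} {f : Poly} (h : pderiv i (pderiv i f) = 0) :
    f = evalVar i 0 f + X i * pderiv i f := by
  have h0 : pderiv i (f - evalVar i 0 f - X i * pderiv i f) = 0 := by
    rw [map_sub, map_sub, pderiv_evalVar_self, pderiv_mul, h]
    simp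
  have h1 := evalVar_of_pderiv_eq_zero h0 0
  rw [map_sub, map_sub, map_mul, evalVar_X_self,
    evalVar_of_pderiv_eq_zero (pderiv_evalVar_self i 0 f), C_0, zero_mul, sub_self, sub_zero] at h1
  linear_combination -h1

/-! ### Iterated derivatives -/

theorem nablas_add (n : ℕ) (f g : Poly) : nablas n (f + g) = nablas n f + nablas n g := by
  induction n with
  | zero => rfl
  | succ n ih => simp [nablas, ih]

theorem nablas_zero (n : ℕ) : nablas n 0 = 0 := by
  induction n with
  | zero => rfl
  | succ n ih => simp [nablas, ih]

theorem nablas_sum {ι : Type*} (s : Finset ι) (n : ℕ) (f : ι → Poly) :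
    nablas n (∑ i ∈ s, f i) = ∑ i ∈ s, nablas n (f i) := by
  classical
  induction s using Finset.induction_on with
  | empty => simp [nablas_zero]
  | insert a s ha ih => rw [Finset.sum_insert ha, Finset.sum_insert ha, nablas_add, ih]

theorem pderiv_nablas (i n : ℕ) (f : Poly) : pderiv i (nablas n f) = nablas n (pderiv i f) := by
  induction n with
  | zero => rfl
  | succ n ih => rw [nablas, pderiv_comm, ih, nablas]

theorem pderiv_nablas_of_lt {f : Poly} (hf : IsMultiaffine f) {i n : ℕ} (h : i < n) :
    pderiv i (nablas n f) = 0 := by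
  induction n with
  | zero => omega
  | succ n ih =>
    rw [nablas]
    rcases eq_or_ne i n with rfl | hi
    · exact hf.nablas i i
    · rw [pderiv_comm, ih (by omega), map_zero]

theorem nablas_eq_zero {f : Poly} {i n : ℕ} (hi : i < n) (h : pderiv i f = 0) :
    nablas n f = 0 := by
  induction n with
  | zero => omega
  | succ n ih =>
    rw [nablas]
    rcases eq_or_ne i n with rfl | hn
    · rw [pderiv_nablas, h, nablas_zero]
    · rw [ih (by omega), map_zero]

/-- The derivative of `f` with respect to all variables in a list. -/
def pderivs (l : List ℕ) (f : Poly) : Poly := l.foldr (fun i g => pderiv i g) f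

theorem pderivs_cons (i : ℕ) (l : List ℕ) (f : Poly) :
    pderivs (i :: l) f = pderiv i (pderivs l f) := rfl

theorem pderivs_append (l l' : List ℕ) (f : Poly) :
    pderivs (l ++ l') f = pderivs l (pderivs l' f) := by
  simp [pderivs]

theorem pderivs_perm {l l' : List ℕ} (h : l.Perm l') (f : Poly) : pderivs l f = pderivs l' f := by
  have : LeftCommutative fun (i : ℕ) (g : Poly) => pderiv i g := ⟨pderiv_comm⟩
  exact h.foldr_eq f

theorem pderivs_range (n : ℕ) (f : Poly) : pderivs (List.range n) f = nablas n f := by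
  induction n with
  | zero => rfl
  | succ n ih =>
    rw [List.range_succ, pderivs_perm List.perm_append_comm, pderivs_append, ih]
    rfl

theorem pderiv_pderivs (i : ℕ) (l : List ℕ) (f : Poly) :
    pderiv i (pderivs l f) = pderivs l (pderiv i f) := by
  induction l with
  | nil => rfl
  | cons a l ih => rw [pderivs_cons, pderiv_comm, ih, pderivs_cons]

theorem pderivs_zero (l : List ℕ) : pderivs l 0 = 0 := by
  induction l with
  | nil => rfl
  | cons a l ih => rw [pderivs_cons, ih, map_zero]

theorem pderivs_mul_of_left {l : List ℕ} {f : Poly} (g : Poly) (h : ∀ i ∈ l, pderiv i f = 0) :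
    pderivs l (f * g) = f * pderivs l g := by
  induction l with
  | nil => rfl
  | cons a l ih =>
    rw [pderivs_cons, ih fun i hi => h i (List.mem_cons_of_mem _ hi), pderiv_mul,
      h a List.mem_cons_self, pderivs_cons]
    ring

/-- Used for two cycles of a cut: each factor is differentiated only in labels that the other one
does not contain. Lists are needed because the labels of one cycle need not form an initial segment.
-/
theorem pderivs_append_mul {l l' : List ℕ} {f g : Poly} (hf : ∀ i ∈ l', pderiv i f = 0)
    (hg : ∀ i ∈ l, pderiv i g = 0) :
    pderivs (l ++ l') (f * g) = pderivs l f * pderivs l' g := by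
  rw [pderivs_append, pderivs_mul_of_left g hf, mul_comm, pderivs_mul_of_left, mul_comm]
  intro i hi
  rw [pderiv_pderivs, hg i hi, pderivs_zero]

theorem pderivs_rename {g : ℕ → ℕ} (hg : Function.Injective g) (l : List ℕ) (f : Poly) :
    pderivs (l.map g) (rename g f) = rename g (pderivs l f) := by
  induction l with
  | nil => rfl
  | cons a l ih => rw [List.map_cons, pderivs_cons, ih, pderiv_rename hg, pderivs_cons]

/-! ### Substitutions -/

theorem pderiv_aeval_eq_zero {i : ℕ} {φ : ℕ → Poly} (h : ∀ n, pderiv i (φ n) = 0) (f : Poly) :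
    pderiv i (aeval φ f) = 0 := by
  induction f using MvPolynomial.induction_on with
  | C a => simp
  | add p q hp hq => rw [map_add, map_add, hp, hq, add_zero]
  | mul_X p n hp => rw [map_mul, pderiv_mul, hp, aeval_X, h]; simp

theorem pderiv_rename_eq_zero {i : ℕ} {g : ℕ → ℕ} (h : ∀ n, g n ≠ i) (f : Poly) :
    pderiv i (rename g f) = 0 := by
  rw [rename_eq_aeval]
  exact pderiv_aeval_eq_zero (fun n => by simp [pderiv_X_of_ne (h n)]) f

theorem IsMultiaffine.rename {g : ℕ → ℕ} (hg : Function.Injective g) {f : Poly}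
    (hf : IsMultiaffine f) : IsMultiaffine (rename g f) := by
  intro i
  by_cases h : ∃ n, g n = i
  · obtain ⟨n, rfl⟩ := h
    rw [pderiv_rename hg, pderiv_rename hg, hf n, map_zero]
  · push Not at h
    rw [pderiv_rename_eq_zero h, map_zero]

theorem aeval_eq_rename {p : ℕ} {φ : ℕ → Poly} {g : ℕ → ℕ} {f : Poly}
    (hf : ∀ i, p ≤ i → pderiv i f = 0) (h : ∀ i, i < p → φ i = X (g i)) :
    aeval φ f = rename g f := by
  rw [rename_eq_aeval]
  refine eval₂Hom_congr' rfl (fun i hi _ => ?_) rfl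
  refine h i (lt_of_not_ge fun hp => ?_)
  exact notMem_vars_of_pderiv_eq_zero (hf i hp) hi

theorem rename_congr {g g' : ℕ → ℕ} {f : Poly} (h : ∀ i, pderiv i f = 0 ∨ g i = g' i) :
    rename g f = rename g' f := by
  rw [rename_eq_aeval, rename_eq_aeval]
  refine eval₂Hom_congr' rfl (fun i hi _ => ?_) rfl
  rcases h i with h | h
  · exact absurd hi (notMem_vars_of_pderiv_eq_zero h)
  · simp [h]

/-! ### The exchange relation -/

theorem diagVar_of_pderiv_eq_zero {j : ℕ} {f : Poly} (h : pderiv (j + 1) f = 0) :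
    diagVar j f = f :=
  aeval_eq_self_of_eqOn_vars fun i hi => by
    rw [Function.update_of_ne]
    rintro rfl
    exact notMem_vars_of_pderiv_eq_zero h hi

theorem exists_bilinear (j : ℕ) {f : Poly} (hf : IsMultiaffine f) :
    ∃ a b c d : Poly, (∀ p ∈ [a, b, c, d], pderiv j p = 0 ∧ pderiv (j + 1) p = 0) ∧
      f = a + X j * b + X (j + 1) * c + X j * X (j + 1) * d := by
  have h1 := eq_evalVar_add_of_pderiv_pderiv (hf (j + 1))
  have h2 := eq_evalVar_add_of_pderiv_pderiv
    (i := j) (f := evalVar (j + 1) 0 f) (by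
      rw [pderiv_evalVar_of_ne (by omega), pderiv_evalVar_of_ne (by omega), hf j, map_zero])
  have h3 := eq_evalVar_add_of_pderiv_pderiv (hf.pderiv (j + 1) j)
  refine ⟨evalVar j 0 (evalVar (j + 1) 0 f), pderiv j (evalVar (j + 1) 0 f),
    evalVar j 0 (pderiv (j + 1) f), pderiv j (pderiv (j + 1) f), ?_, ?_⟩
  · intro p hp
    simp only [List.mem_cons, List.not_mem_nil, or_false] at hp
    rcases hp with rfl | rfl | rfl | rfl
    · refine ⟨pderiv_evalVar_self _ _ _, ?_⟩
      rw [pderiv_evalVar_of_ne (by omega), pderiv_evalVar_self, map_zero]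
    · refine ⟨?_, ?_⟩
      · rw [pderiv_evalVar_of_ne (by omega), pderiv_evalVar_of_ne (by omega), hf j, map_zero]
      · rw [pderiv_comm, pderiv_evalVar_self, map_zero]
    · refine ⟨pderiv_evalVar_self _ _ _, ?_⟩
      rw [pderiv_evalVar_of_ne (by omega), hf, map_zero]
    · refine ⟨hf.pderiv (j + 1) j, ?_⟩
      rw [pderiv_comm, hf, map_zero]
  · linear_combination h1 + h2 + X (j + 1) * h3

/-- With bilinear coefficients `b, c` of `f` and `b', c'` of `g` in the two positions, continuity
gives `b + c = b' + c'` and gluing gives `b - c + b' - c' = 2r`. Adding them yields `b = c' + r`: a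
hole moves from `j + 1` to `j`, with `r` as correction. -/
theorem exchange {j : ℕ} {f g r : Poly} (hf : IsMultiaffine f) (hg : IsMultiaffine g)
    (hc : diagVar j f = diagVar j g)
    (hd : diagVar j (pderiv j (f + g) - pderiv (j + 1) (f + g)) = 2 * r) :
    evalVar (j + 1) 0 (pderiv j f) = evalVar j 0 (pderiv (j + 1) g) + r := by
  obtain ⟨a, b, c, d, h, rfl⟩ := exists_bilinear j hf
  obtain ⟨a', b', c', d', h', rfl⟩ := exists_bilinear j hg
  simp only [List.mem_cons, List.not_mem_nil, or_false, forall_eq_or_imp, forall_eq] at h h'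
  obtain ⟨⟨a0, a1⟩, ⟨b0, b1⟩, ⟨c0, c1⟩, ⟨d0, d1⟩⟩ := h
  obtain ⟨⟨a0', a1'⟩, ⟨b0', b1'⟩, ⟨c0', c1'⟩, ⟨d0', d1'⟩⟩ := h'
  have n1 : j ≠ j + 1 := by omega
  have n2 : j + 1 ≠ j := by omega
  have x0 : diagVar j (X j) = X j := diagVar_of_pderiv_eq_zero (pderiv_X_of_ne n1)
  have x1 : diagVar j (X (j + 1)) = X j := by simp [diagVar]
  have hcb : b + c = b' + c' := by
    simp only [map_add, map_mul, diagVar_of_pderiv_eq_zero, *] at hc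
    -- On the diagonal both sides are quadratic in `X j`; this extracts the linear coefficient.
    have := congrArg (fun p => evalVar j 0 (pderiv j p)) hc
    simpa [evalVar_of_pderiv_eq_zero, a0, a0', b0, b0', c0, c0', d0, d0'] using this
  have hdb : b - c + (b' - c') = 2 * r := by
    rw [← hd]
    simp [diagVar_of_pderiv_eq_zero, pderiv_X_of_ne n1, pderiv_X_of_ne n2, x1,
      a0, a0', b0, b0', c0, c0', d0, d0', a1, a1', b1, b1', c1, c1', d1, d1']
    ring
  have h2 : (2 : Poly) * (b - c' - r) = 0 := by linear_combination hcb + hdb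
  have h3 : b - c' - r = 0 := (mul_eq_zero.1 h2).resolve_left two_ne_zero
  simp [evalVar_of_pderiv_eq_zero, pderiv_X_of_ne n1, pderiv_X_of_ne n2,
    a0, b0, c0, c0', d0, d0', a1', b1, b1', c1', d1, d1']
  linear_combination h3

/-! ### Loops and their cycles -/

theorem IsLoop.conj {P : ℕ} {σ : Equiv.Perm (Fin P)} (h : IsLoop σ) (ρ : Equiv.Perm (Fin P)) :
    IsLoop (conj ρ σ) := by
  have := Equiv.Perm.IsCycleOn.conj (g := ρ) h
  rwa [Set.image_univ, ρ.range_eq_univ] at this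

theorem isLoop_finRotate (P : ℕ) : IsLoop (finRotate P) := by
  rcases lt_or_ge P 2 with h | h
  · have : Subsingleton (Fin P) := by
      have : P = 0 ∨ P = 1 := by omega
      rcases this with rfl | rfl <;> infer_instance
    exact Equiv.Perm.isCycleOn_of_subsingleton _ _
  · have := (isCycle_finRotate_of_le h).isCycleOn
    have h2 : {x | finRotate P x ≠ x} = Set.univ := by
      ext x
      have := support_finRotate_of_le h
      simpa using (Finset.ext_iff.1 this x)
    rwa [h2] at this

theorem isLoop_deformedLoop {m : ℕ} (μ : Equiv.Perm (Fin m)) (n P : ℕ) :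
    IsLoop (deformedLoop μ n P) :=
  (isLoop_finRotate P).conj _

theorem isLoop_cyclePerm {P : ℕ} (π : Equiv.Perm (Fin P)) (a : Fin P) :
    IsLoop (cyclePerm π a) := by
  refine ⟨Set.bijOn_univ.2 (cyclePerm π a).bijective, fun x _ y _ => ?_⟩
  set e := ((cyclePoints π a).orderIsoOfFin rfl).toEquiv
  have h1 : π.SameCycle (e x : Fin P) (e y) :=
    ((mem_cyclePoints π a _).1 (e x).2).symm.trans ((mem_cyclePoints π a _).1 (e y).2)
  obtain ⟨z, hz⟩ := (Equiv.Perm.sameCycle_subtypePerm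
    (h := apply_mem_cyclePoints π a) (x := e x) (y := e y)).2 h1
  refine ⟨z, ?_⟩
  have : cyclePerm π a ^ z
      = e.symm.permCongr (π.subtypePerm (apply_mem_cyclePoints π a) ^ z) :=
    (map_zpow e.symm.permCongrHom _ z).symm
  rw [this]
  rw [Equiv.permCongr_apply, Equiv.symm_symm, hz, Equiv.symm_apply_apply]

theorem IsLoop.sign {P : ℕ} {σ : Equiv.Perm (Fin P)} (h : IsLoop σ) (hP : 2 ≤ P) :
    Equiv.Perm.sign σ = -(-1) ^ P := by
  have hn : Nontrivial (Fin P) := Fin.nontrivial_iff_two_le.2 hP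
  have hne : (Set.univ : Set (Fin P)).Nontrivial := Set.nontrivial_univ
  have hc : σ.IsCycle := Equiv.Perm.isCycle_iff_exists_isCycleOn.2
    ⟨Set.univ, hne, h, fun x _ => Set.mem_univ x⟩
  have hs : σ.support = Finset.univ := by
    ext x
    simpa using h.apply_ne hne (Set.mem_univ x)
  rw [hc.sign, hs, Finset.card_univ, Fintype.card_fin]

/-- Otherwise the product would again be a single cycle through all points: along the `σ`-orbit of
`a`, each new point is `a`, `b`, or the image of the previous one under the product. But multiplying
by a transposition flips the sign, while all loops on `P` points have the same sign. -/
theorem not_sameCycle_swap_mul {P : ℕ} {σ : Equiv.Perm (Fin P)} (h : IsLoop σ) {a b : Fin P}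
    (hab : a ≠ b) : ¬ (Equiv.swap a b * σ).SameCycle a b := by
  intro hs
  set π := Equiv.swap a b * σ with hπ
  have key : ∀ x, π.SameCycle a x := by
    intro x
    obtain ⟨n, rfl⟩ := (h.2 (Set.mem_univ a) (Set.mem_univ x)).exists_nat_pow_eq
    induction n with
    | zero => exact Equiv.Perm.SameCycle.refl _ _
    | succ n ih =>
      rw [pow_succ', Equiv.Perm.mul_apply]
      by_cases h1 : σ ((σ ^ n) a) = a
      · rw [h1]
      by_cases h2 : σ ((σ ^ n) a) = b
      · rwa [h2]
      have h3 : π ((σ ^ n) a) = σ ((σ ^ n) a) := Equiv.swap_apply_of_ne_of_ne h1 h2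
      rw [← h3]
      exact Equiv.Perm.sameCycle_apply_right.2 ih
  have hl : IsLoop π :=
    ⟨Set.bijOn_univ.2 π.bijective, fun x _ y _ => (key x).symm.trans (key y)⟩
  have hP : 2 ≤ P := by
    have h1 := a.2
    have h2 := b.2
    have h3 : (a : ℕ) ≠ b := fun h => hab (Fin.ext h)
    omega
  have h1 := hl.sign hP
  rw [hπ, Equiv.Perm.sign_mul, Equiv.Perm.sign_swap hab, h.sign hP] at h1
  have h2 : ((-1 : ℤˣ)) ^ P = 1 ∨ (-1 : ℤˣ) ^ P = -1 := neg_one_pow_eq_or _ _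
  rcases h2 with h2 | h2 <;> rw [h2] at h1 <;> revert h1 <;> decide

theorem tau_eq_swap {P j : ℕ} (h : j + 1 < P) :
    tau P j = Equiv.swap ⟨j, by omega⟩ ⟨j + 1, h⟩ := by
  rw [tau, dif_pos h]

theorem cyclePoints_eq_map {P p : ℕ} {π : Equiv.Perm (Fin P)} {ρ : Equiv.Perm (Fin p)}
    (e : Fin p ↪o Fin P) (hρ : IsLoop ρ) (he : ∀ i, π (e i) = e (ρ i)) (i : Fin p) :
    cyclePoints π (e i) = Finset.univ.map e.toEmbedding := by
  have hpow : ∀ n x, (π ^ n) (e x) = e ((ρ ^ n) x) := by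
    intro n x
    induction n with
    | zero => rfl
    | succ n ih => rw [pow_succ', pow_succ', Equiv.Perm.mul_apply, ih, he, Equiv.Perm.mul_apply]
  ext x
  rw [mem_cyclePoints]
  simp only [Finset.mem_map, Finset.mem_univ, true_and, RelEmbedding.coe_toEmbedding]
  constructor
  · intro h
    obtain ⟨n, hn⟩ := h.exists_nat_pow_eq
    exact ⟨_, (hpow n i).symm.trans hn⟩
  · rintro ⟨y, rfl⟩
    obtain ⟨n, hn⟩ := (hρ.2 (Set.mem_univ i) (Set.mem_univ y)).exists_nat_pow_eq
    exact ⟨n, by rw [zpow_natCast, hpow, hn]⟩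

/-- An order embedding intertwining a loop `ρ` with `π` must be the increasing enumeration of the
cycle of `π`, by uniqueness of that enumeration. This turns the abstract relabeling into a concrete
one. -/
theorem subLoop_eq_aeval (F : LoopFamily) {P p : ℕ} {π : Equiv.Perm (Fin P)}
    {ρ : Equiv.Perm (Fin p)} (e : Fin p ↪o Fin P) (hρ : IsLoop ρ)
    (he : ∀ i, π (e i) = e (ρ i)) (i₀ : Fin p) :
    subLoop F π (e i₀)
      = aeval (fun i : ℕ => if h : i < p then (X (e ⟨i, h⟩ : ℕ) : Poly) else 0) (F p ρ) := by
  have hs := cyclePoints_eq_map e hρ he i₀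
  have hp : (cyclePoints π (e i₀)).card = p := by rw [hs]; simp
  obtain ⟨a, ha⟩ : ∃ a, a = e i₀ := ⟨_, rfl⟩
  -- The base point is made a free variable, so that `p` can be replaced by the cardinality in the
  -- dependent types.
  rw [← ha] at hs hp ⊢
  clear ha i₀
  subst hp
  have hemb : e = (cyclePoints π a).orderEmbOfFin rfl :=
    Finset.orderEmbOfFin_unique' _ fun i =>
      (Finset.ext_iff.1 hs (e i)).2 (by simp)
  have hperm : cyclePerm π a = ρ := by
    ext1 i
    refine ((cyclePoints π a).orderEmbOfFin rfl).injective ?_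
    rw [← hemb, ← he, hemb]
    simp [cyclePerm, Equiv.permCongr_apply, ← Finset.coe_orderIsoOfFin_apply]
  rw [subLoop, dif_pos a.2]
  simp only [Fin.eta]
  rw [hperm, ← hemb]

theorem subLoop_eq_rename (F : LoopFamily) {P p : ℕ} {π : Equiv.Perm (Fin P)}
    {ρ : Equiv.Perm (Fin p)} (hρ : IsLoop ρ) (hF : ∀ i, p ≤ i → pderiv i (F p ρ) = 0)
    {g : ℕ → ℕ} (hg : ∀ i i', i < i' → i' < p → g i < g i') (hgP : ∀ i, i < p → g i < P)
    (hπ : ∀ (i : ℕ) (hi : i < p), (π ⟨g i, hgP i hi⟩ : ℕ) = g (ρ ⟨i, hi⟩))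
    {i₀ : ℕ} (hi₀ : i₀ < p) : subLoop F π (g i₀) = rename g (F p ρ) := by
  let e : Fin p ↪o Fin P := OrderEmbedding.ofStrictMono (fun i => ⟨g i, hgP i i.2⟩)
    fun i i' h => hg i i' h i'.2
  have := subLoop_eq_aeval F e hρ (fun i => Fin.ext (hπ i i.2)) ⟨i₀, hi₀⟩
  refine Eq.trans this (aeval_eq_rename hF fun i hi => ?_)
  rw [dif_pos hi]
  rfl

/-- An injective extension to all labels of the order preserving enumeration of a set of
labels. -/
theorem exists_injective_extension {P : ℕ} (s : Finset (Fin P)) :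
    ∃ g : ℕ → ℕ, Function.Injective g ∧
      ∀ (i : ℕ) (hi : i < s.card), g i = (s.orderEmbOfFin rfl ⟨i, hi⟩ : Fin P) := by
  refine ⟨fun i => if hi : i < s.card then (s.orderEmbOfFin rfl ⟨i, hi⟩ : Fin P) else P + i,
    fun i i' h => ?_, fun i hi => dif_pos hi⟩
  dsimp only at h
  split_ifs at h with h1 h2 h2
  · have := (s.orderEmbOfFin rfl).injective (Fin.ext h)
    exact congrArg Fin.val this
  · have := (s.orderEmbOfFin rfl ⟨i, h1⟩).2
    omega
  · have := (s.orderEmbOfFin rfl ⟨i', h2⟩).2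
    omega
  · omega

theorem isMultiaffine_subLoop {F : LoopFamily} {P : ℕ} {π : Equiv.Perm (Fin P)} {a : Fin P}
    (hv : ∀ i, (cyclePoints π a).card ≤ i → pderiv i (F _ (cyclePerm π a)) = 0)
    (hF : IsMultiaffine (F _ (cyclePerm π a))) : IsMultiaffine (subLoop F π a) := by
  obtain ⟨g, hg, hgs⟩ := exists_injective_extension (cyclePoints π a)
  have : subLoop F π a = rename g (F _ (cyclePerm π a)) := by
    rw [subLoop, dif_pos a.2]
    refine aeval_eq_rename hv fun i hi => ?_
    rw [dif_pos hi, hgs i hi]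
  rw [this]
  exact hF.rename hg

theorem pderiv_subLoop_eq_zero (F : LoopFamily) {P : ℕ} (π : Equiv.Perm (Fin P)) (a : Fin P)
    {i : ℕ} (h : ∀ hi : i < P, ¬ π.SameCycle a ⟨i, hi⟩) : pderiv i (subLoop F π a) = 0 := by
  rw [subLoop, dif_pos a.2]
  refine pderiv_aeval_eq_zero (fun n => ?_) _
  split_ifs with hn
  · refine pderiv_X_of_ne fun hi => ?_
    have hmem := Finset.orderEmbOfFin_mem (cyclePoints π a) rfl ⟨n, hn⟩
    rw [mem_cyclePoints] at hmem
    have hlt : i < P := by rw [← hi]; exact Fin.is_lt _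
    refine h hlt ?_
    convert hmem using 1
    exact Fin.ext hi.symm
  · exact map_zero _

theorem card_cyclePoints_lt {P : ℕ} {π : Equiv.Perm (Fin P)} {a b : Fin P}
    (h : ¬ π.SameCycle a b) : (cyclePoints π a).card < P := by
  have : cyclePoints π a ⊂ Finset.univ := by
    refine Finset.ssubset_univ_iff.2 fun hu => h ?_
    rw [← mem_cyclePoints, hu]
    exact Finset.mem_univ b
  simpa using Finset.card_lt_card this

/-! ### Regular loops cut by a transposition -/

theorem tau_apply {P j : ℕ} (h : j + 1 < P) (i : Fin P) :
    ((tau P j i : Fin P) : ℕ) = if (i : ℕ) = j then j + 1 else if (i : ℕ) = j + 1 then j else i := by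
  rw [tau_eq_swap h, Equiv.swap_apply_def]
  simp only [Fin.ext_iff]
  split_ifs <;> rfl

theorem finRotate_val {P : ℕ} (i : Fin P) :
    ((finRotate P i : Fin P) : ℕ) = if (i : ℕ) + 1 = P then (0 : ℕ) else (i : ℕ) + 1 := by
  cases P with
  | zero => exact i.elim0
  | succ P => rw [coe_finRotate]; simp only [Fin.ext_iff, Fin.val_last, Nat.succ_eq_add_one, add_left_inj]

theorem slide_succ_top {k j : ℕ} (h : k + 1 ≤ j) (P : ℕ) :
    slide P k (j + 1) = slide P k j * tau P j := by
  rw [slide, List.Ico.succ_top h]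
  simp [slide]

theorem slide_self (P j : ℕ) : slide P j (j + 1) = 1 := by
  simp [slide]

theorem slide_apply {P k j : ℕ} (hk : k < j) (hj : j < P) (i : Fin P) :
    ((slide P k j i : Fin P) : ℕ)
      = if (i : ℕ) ≤ k ∨ j < i then (i : ℕ) else if (i : ℕ) = j then k + 1 else i + 1 := by
  induction j, hk using Nat.le_induction generalizing i with
  | base =>
    rw [slide_self]
    simp only [Equiv.Perm.one_apply]
    split_ifs <;> omega
  | succ j hk ih =>
    rw [slide_succ_top hk, Equiv.Perm.mul_apply, ih (by omega), tau_apply hj]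
    split_ifs <;> omega

/-- The cut separates the labels into `k, k+2, …, j` and the remaining ones `…, k-1, k+1, j+1, …`,
each traversed in increasing cyclic order. This lemma treats the first cycle, the next one the
second. -/
theorem tau_mul_conj_slide_minus {P k j : ℕ} (hk : k < j) (hj : j < P) {x y : Fin P}
    (hx : (x : ℕ) = k ∨ k + 2 ≤ (x : ℕ) ∧ (x : ℕ) ≤ j)
    (hy : (y : ℕ) = if (x : ℕ) = j ∨ j = k + 1 then k else if (x : ℕ) = k then k + 2 else x + 1) :
    (tau P k * conj (slide P k j) (finRotate P)) x = y := by
  have hinv : ((slide P k j)⁻¹ x : Fin P) = ⟨if (x : ℕ) = k then k else x - 1, by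
      have := x.2; split_ifs <;> omega⟩ := by
    rw [Equiv.Perm.inv_eq_iff_eq, Fin.ext_iff, slide_apply hk hj]
    dsimp only
    split_ifs <;> omega
  rw [conj, Equiv.Perm.mul_apply, Equiv.Perm.mul_apply, Equiv.Perm.mul_apply, Fin.ext_iff]
  rw [Fin.ext_iff] at hinv
  generalize (slide P k j)⁻¹ x = a at hinv ⊢
  have hb := finRotate_val a
  generalize finRotate P a = b at hb ⊢
  have hc := slide_apply hk hj b
  generalize slide P k j b = c at hc ⊢
  have hd := tau_apply (j := k) (by omega) c
  generalize tau P k c = d at hd ⊢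
  have := x.2
  rcases hx with hx | hx <;> split_ifs at hy <;> split_ifs at hinv <;> dsimp only at hinv <;>
    split_ifs at hb <;> split_ifs at hc <;> first | omega | (split_ifs at hd <;> omega)

theorem tau_mul_conj_slide_plus {P k j : ℕ} (hk : k < j) (hj : j < P) {x y : Fin P}
    (hx : (x : ℕ) < k ∨ (x : ℕ) = k + 1 ∨ j < (x : ℕ))
    (hy : (y : ℕ) = if (x : ℕ) + 1 = k ∨ k = 0 ∧ ((x : ℕ) + 1 = P ∨ (x : ℕ) = k + 1 ∧ j + 1 = P)
        then k + 1
      else if (x : ℕ) = k + 1 then (if j + 1 = P then 0 else j + 1)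
      else if (x : ℕ) + 1 = P then 0 else x + 1) :
    (tau P k * conj (slide P k j) (finRotate P)) x = y := by
  have hinv : ((slide P k j)⁻¹ x : Fin P) = ⟨if (x : ℕ) = k + 1 then j else x, by
      have := x.2; split_ifs <;> omega⟩ := by
    rw [Equiv.Perm.inv_eq_iff_eq, Fin.ext_iff, slide_apply hk hj]
    dsimp only
    split_ifs <;> omega
  rw [conj, Equiv.Perm.mul_apply, Equiv.Perm.mul_apply, Equiv.Perm.mul_apply, Fin.ext_iff]
  rw [Fin.ext_iff] at hinv
  generalize (slide P k j)⁻¹ x = a at hinv ⊢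
  have hb := finRotate_val a
  generalize finRotate P a = b at hb ⊢
  have hc := slide_apply hk hj b
  generalize slide P k j b = c at hc ⊢
  have hd := tau_apply (j := k) (by omega) c
  generalize tau P k c = d at hd ⊢
  have := x.2
  rcases hx with hx | hx <;> split_ifs at hy <;> split_ifs at hinv <;> dsimp only at hinv <;>
    split_ifs at hb <;> split_ifs at hc <;> first | omega | (split_ifs at hd <;> omega)

/-! ### Deformations -/

theorem deformation_apply {m : ℕ} (μ : Equiv.Perm (Fin m)) {n P : ℕ} (h : n - 1 + m ≤ P)
    (x : Fin P) :
    ((deformation μ n P x : Fin P) : ℕ)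
      = if hx : n - 1 ≤ (x : ℕ) ∧ (x : ℕ) < n - 1 + m then
          n - 1 + μ ⟨x - (n - 1), by omega⟩ else (x : ℕ) := by
  rw [deformation, dif_pos h]
  split_ifs with hx
  · set ι : Fin m ↪ Fin P := ⟨fun i => ⟨n - 1 + i, by omega⟩, fun i i' hi => by
      simp only [Fin.mk.injEq] at hi; exact Fin.ext (by omega)⟩
    have : x = ι ⟨x - (n - 1), by omega⟩ := Fin.ext (by
      change (x : ℕ) = n - 1 + (x - (n - 1))
      omega)
    conv_lhs => rw [this, Equiv.Perm.viaEmbedding_apply]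
    rfl
  · rw [Equiv.Perm.viaEmbedding_apply_of_notMem]
    rintro ⟨i, rfl⟩
    exact hx ⟨Nat.le_add_right _ _, Nat.add_lt_add_left i.2 _⟩

theorem deformation_apply_of_lt {m : ℕ} (μ : Equiv.Perm (Fin m)) {n P : ℕ} {x : Fin P}
    (h : n - 1 + m ≤ P) (hx : (x : ℕ) < n - 1) : deformation μ n P x = x := by
  rw [Fin.ext_iff, deformation_apply μ h, dif_neg (by omega)]

theorem commute_deformation {m : ℕ} (μ : Equiv.Perm (Fin m)) {n P : ℕ} (h : n - 1 + m ≤ P)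
    {ρ : Equiv.Perm (Fin P)} (hρ : ∀ x : Fin P, n - 1 ≤ (x : ℕ) → ρ x = x) :
    Commute (deformation μ n P) ρ :=
  Equiv.Perm.Disjoint.commute fun x => by
    rcases lt_or_ge (x : ℕ) (n - 1) with hx | hx
    · exact Or.inl (deformation_apply_of_lt μ h hx)
    · exact Or.inr (hρ x hx)

/-- The slide and the transposition move only labels up to `j`, which lie to the left of the support
of the deformation, so both commute with it. -/
theorem tau_mul_conj_slide_deformedLoop {m : ℕ} (μ : Equiv.Perm (Fin m)) {n P k j : ℕ}
    (h : n - 1 + m ≤ P) (hk : k < j) (hj : j < P) (hn : j < n - 1) :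
    tau P k * conj (slide P k j) (deformedLoop μ n P)
      = conj (deformation μ n P) (tau P k * conj (slide P k j) (finRotate P)) := by
  have h1 : Commute (deformation μ n P) (tau P k) := commute_deformation μ h fun x hx => by
    rw [Fin.ext_iff, tau_apply (by omega)]
    split_ifs <;> omega
  have h2 : Commute (deformation μ n P) (slide P k j) := commute_deformation μ h fun x hx => by
    rw [Fin.ext_iff, slide_apply hk hj]
    split_ifs <;> omega
  have h3 := h2.inv_inv
  simp only [deformedLoop, conj]
  calc _ = tau P k * (slide P k j * deformation μ n P) * finRotate P *
        ((deformation μ n P)⁻¹ * (slide P k j)⁻¹) := by group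
    _ = (tau P k * deformation μ n P) * slide P k j * finRotate P *
        ((slide P k j)⁻¹ * (deformation μ n P)⁻¹) := by rw [h3.eq, ← h2.eq]; group
    _ = _ := by rw [← h1.eq]; group

/-! ### Families with an explicit hole coefficient -/

/-- The loops with `P` points are polynomials in the positions of these points, affine in each
of them. -/
def IsMultiaffineAt (F : LoopFamily) (P : ℕ) : Prop :=
  ∀ σ : Equiv.Perm (Fin P), IsLoop σ →
    (∀ i, P ≤ i → pderiv i (F P σ) = 0) ∧ IsMultiaffine (F P σ)

/-- The consequences of the stationarity conditions that determine the hole coefficients. -/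
structure HasHoleFormula (F : LoopFamily) : Prop where
  multiaffine : ∀ P, 0 < P → IsMultiaffineAt F P
  one_point : pderiv 0 (F 1 1) = 1
  hole : ∀ (P : ℕ) (σ : Equiv.Perm (Fin P)), IsLoop σ → ∀ j, 1 ≤ j → j < P →
    evalVar j 0 (nablas j (F P σ)) = holeFormula F σ j
  full : ∀ (P : ℕ) (σ : Equiv.Perm (Fin (P + 1))), IsLoop σ → 1 ≤ P →
    nablas (P + 1) (F (P + 1) σ) = -evalVar P 0 (nablas P (F (P + 1) σ))

section SubLoops

variable {P : ℕ} {σ : Equiv.Perm (Fin P)} {j : ℕ}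

theorem not_sameCycle_tau_mul (h : IsLoop σ) (hj : j + 1 < P) :
    ¬ (tau P j * σ).SameCycle ⟨j, by omega⟩ ⟨j + 1, hj⟩ := by
  rw [tau_eq_swap hj]
  exact not_sameCycle_swap_mul h fun h => by simp at h

theorem pderiv_minusLoop_eq_zero_of_le (F : LoopFamily) (hj : j + 1 < P) {i : ℕ} (hi : P ≤ i) :
    pderiv i (minusLoop F σ j) = 0 :=
  pderiv_subLoop_eq_zero F (tau P j * σ) ⟨j, by omega⟩ fun h => absurd h (by omega)

theorem pderiv_plusLoop_eq_zero_of_le (F : LoopFamily) (hj : j + 1 < P) {i : ℕ} (hi : P ≤ i) :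
    pderiv i (plusLoop F σ j) = 0 :=
  pderiv_subLoop_eq_zero F (tau P j * σ) ⟨j + 1, hj⟩ fun h => absurd h (by omega)

theorem pderiv_succ_minusLoop (F : LoopFamily) (h : IsLoop σ) (hj : j + 1 < P) :
    pderiv (j + 1) (minusLoop F σ j) = 0 :=
  pderiv_subLoop_eq_zero F (tau P j * σ) ⟨j, by omega⟩ fun _ => not_sameCycle_tau_mul h hj

theorem pderiv_plusLoop (F : LoopFamily) (h : IsLoop σ) (hj : j + 1 < P) :
    pderiv j (plusLoop F σ j) = 0 :=
  pderiv_subLoop_eq_zero F (tau P j * σ) ⟨j + 1, hj⟩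
    fun _ hs => not_sameCycle_tau_mul h hj hs.symm

theorem pderiv_minusLoop_or_plusLoop (F : LoopFamily) (h : IsLoop σ) (hj : j + 1 < P) (i : ℕ) :
    pderiv i (minusLoop F σ j) = 0 ∨ pderiv i (plusLoop F σ j) = 0 := by
  by_cases hi : ∃ hi : i < P, (tau P j * σ).SameCycle ⟨j, by omega⟩ ⟨i, hi⟩
  · obtain ⟨hi, hs⟩ := hi
    exact Or.inr (pderiv_subLoop_eq_zero F (tau P j * σ) ⟨j + 1, hj⟩
      fun _ hs' => not_sameCycle_tau_mul h hj (hs.trans hs'.symm))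
  · exact Or.inl (pderiv_subLoop_eq_zero F (tau P j * σ) ⟨j, by omega⟩
      fun hi' hs => hi ⟨hi', hs⟩)

theorem card_cyclePoints_pos (π : Equiv.Perm (Fin P)) (a : Fin P) :
    0 < (cyclePoints π a).card :=
  Finset.card_pos.2 ⟨a, (mem_cyclePoints π a a).2 (Equiv.Perm.SameCycle.refl _ _)⟩

theorem isMultiaffine_minusLoop {F : LoopFamily}
    (hF : ∀ Q, 0 < Q → Q < P → IsMultiaffineAt F Q) (h : IsLoop σ) (hj : j + 1 < P) :
    IsMultiaffine (minusLoop F σ j) := by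
  have h1 := hF _ (card_cyclePoints_pos _ _) (card_cyclePoints_lt (not_sameCycle_tau_mul h hj)) _
    (isLoop_cyclePerm (tau P j * σ) ⟨j, by omega⟩)
  exact isMultiaffine_subLoop (π := tau P j * σ) (a := ⟨j, by omega⟩) h1.1 h1.2

theorem isMultiaffine_plusLoop {F : LoopFamily}
    (hF : ∀ Q, 0 < Q → Q < P → IsMultiaffineAt F Q) (h : IsLoop σ) (hj : j + 1 < P) :
    IsMultiaffine (plusLoop F σ j) := by
  have h1 := hF _ (card_cyclePoints_pos _ _)
    (card_cyclePoints_lt fun hs => not_sameCycle_tau_mul h hj hs.symm) _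
    (isLoop_cyclePerm (tau P j * σ) ⟨j + 1, hj⟩)
  exact isMultiaffine_subLoop (π := tau P j * σ) (a := ⟨j + 1, hj⟩) h1.1 h1.2

/-- The two cycles of a cut have no label in common, so no variable occurs in both factors. -/
theorem isMultiaffine_minusLoop_mul_plusLoop {F : LoopFamily}
    (hF : ∀ Q, 0 < Q → Q < P → IsMultiaffineAt F Q) (h : IsLoop σ) (hj : j + 1 < P) :
    IsMultiaffine (minusLoop F σ j * plusLoop F σ j) :=
  IsMultiaffine.mul (isMultiaffine_minusLoop hF h hj) (isMultiaffine_plusLoop hF h hj)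
    (pderiv_minusLoop_or_plusLoop F h hj)

theorem minusLoop_congr {F G : LoopFamily} (hFG : ∀ Q, Q < P → F Q = G Q) (h : IsLoop σ)
    (hj : j + 1 < P) : minusLoop F σ j = minusLoop G σ j := by
  rw [minusLoop, minusLoop, subLoop, subLoop, dif_pos (by omega), dif_pos (by omega),
    hFG _ (card_cyclePoints_lt (not_sameCycle_tau_mul h hj))]

theorem plusLoop_congr {F G : LoopFamily} (hFG : ∀ Q, Q < P → F Q = G Q) (h : IsLoop σ)
    (hj : j + 1 < P) : plusLoop F σ j = plusLoop G σ j := by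
  rw [plusLoop, plusLoop, subLoop, subLoop, dif_pos hj, dif_pos hj,
    hFG _ (card_cyclePoints_lt fun hs => not_sameCycle_tau_mul h hj hs.symm)]

/-- Both cycles of a cut are strictly shorter than `P`. This allows the truncated family in the
recursion for `explicitLoop` to be replaced by the full one. -/
theorem holeFormula_congr {F G : LoopFamily} (hFG : ∀ Q, Q < P → F Q = G Q) (h : IsLoop σ)
    (hj : j < P) : holeFormula F σ j = holeFormula G σ j := by
  rw [holeFormula, holeFormula]
  congr 1
  refine Finset.sum_congr rfl fun k hk => ?_
  have := Finset.mem_range.1 hk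
  rw [minusLoop_congr hFG (h.conj _) (by omega), plusLoop_congr hFG (h.conj _) (by omega)]

theorem isMultiaffine_holeSum {F : LoopFamily}
    (hF : ∀ Q, 0 < Q → Q < P → IsMultiaffineAt F Q) (h : IsLoop σ) (hj : j < P) :
    IsMultiaffine (∑ k ∈ Finset.range j,
      minusLoop F (conj (slide P k j) σ) k * plusLoop F (conj (slide P k j) σ) k) :=
  IsMultiaffine.sum fun k hk => isMultiaffine_minusLoop_mul_plusLoop hF (h.conj _) (by
    have := Finset.mem_range.1 hk
    omega)

theorem isMultiaffine_holeFormula {F : LoopFamily}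
    (hF : ∀ Q, 0 < Q → Q < P → IsMultiaffineAt F Q) (h : IsLoop σ) (hj : j < P) :
    IsMultiaffine (holeFormula F σ j) :=
  (isMultiaffine_holeSum hF h hj).nablas _

theorem pderiv_holeFormula_of_le {F : LoopFamily}
    (hF : ∀ Q, 0 < Q → Q < P → IsMultiaffineAt F Q) (h : IsLoop σ) (hj : j < P) {i : ℕ}
    (hi : i ≤ j) : pderiv i (holeFormula F σ j) = 0 :=
  pderiv_nablas_of_lt (isMultiaffine_holeSum hF h hj) (by omega)

theorem pderiv_holeFormula_of_ge (F : LoopFamily) (hj : j < P) {i : ℕ}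
    (hi : P ≤ i) : pderiv i (holeFormula F σ j) = 0 := by
  rw [holeFormula, pderiv_nablas, map_sum, Finset.sum_eq_zero, nablas_zero]
  intro k hk
  have := Finset.mem_range.1 hk
  rw [pderiv_mul, pderiv_minusLoop_eq_zero_of_le F (by omega) hi,
    pderiv_plusLoop_eq_zero_of_le F (by omega) hi]
  simp

end SubLoops

/-! ### Stationary families -/

theorem IsStationary.isMultiaffineAt {F : LoopFamily} (hF : IsStationary F) (P : ℕ) :
    IsMultiaffineAt F P := fun σ hσ =>
  ⟨fun i hi => pderiv_eq_zero_of_notMem_vars fun h => by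
      have := Finset.mem_range.1 (hF.vars_subset P σ hσ h)
      omega,
    isMultiaffine_of_degreeOf_le (hF.degreeOf_le P σ hσ)⟩

theorem conj_slide_succ {P k j : ℕ} (h : k < j) (σ : Equiv.Perm (Fin P)) :
    conj (slide P k (j + 1)) σ = conj (slide P k j) (conj (tau P j) σ) := by
  rw [slide_succ_top h]
  simp only [conj]
  group

theorem holeFormula_succ {F : LoopFamily} {P j : ℕ} {σ : Equiv.Perm (Fin P)} (h : IsLoop σ)
    (hj : j + 1 < P) :
    holeFormula F σ (j + 1) = pderiv (j + 1) (holeFormula F (conj (tau P j) σ) j)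
      + nablas j (pderiv j (minusLoop F σ j) * pderiv (j + 1) (plusLoop F σ j)) := by
  have h1 : conj (slide P j (j + 1)) σ = σ := by simp [slide_self, conj]
  have h2 : ∀ k ∈ Finset.range j, minusLoop F (conj (slide P k (j + 1)) σ) k *
      plusLoop F (conj (slide P k (j + 1)) σ) k =
      minusLoop F (conj (slide P k j) (conj (tau P j) σ)) k *
      plusLoop F (conj (slide P k j) (conj (tau P j) σ)) k := fun k hk => by
    rw [conj_slide_succ (Finset.mem_range.1 hk)]
  -- The new summand `k = j` has an empty slide, and its two outermost derivatives fall on different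
  -- factors.
  have h3 : pderiv (j + 1) (pderiv j (minusLoop F σ j * plusLoop F σ j))
      = pderiv j (minusLoop F σ j) * pderiv (j + 1) (plusLoop F σ j) := by
    rw [pderiv_mul, pderiv_plusLoop F h hj, mul_zero, add_zero, pderiv_mul, pderiv_comm,
      pderiv_succ_minusLoop F h hj, map_zero, zero_mul, zero_add]
  rw [holeFormula, Finset.sum_range_succ, nablas_add, h1, Finset.sum_congr rfl h2, holeFormula,
    ← h3, ← pderiv_nablas, ← pderiv_nablas]
  rfl

/-- Induction on the position of the hole: at the left end it vanishes by the boundary condition,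
and `exchange` matches the recursion `holeFormula_succ`. -/
theorem IsStationary.hole {F : LoopFamily} (hF : IsStationary F) {P : ℕ} (hP : 2 ≤ P) {j : ℕ}
    (hj : j < P) {σ : Equiv.Perm (Fin P)} (h : IsLoop σ) :
    evalVar j 0 (nablas j (F P σ)) = holeFormula F σ j := by
  induction j generalizing σ with
  | zero =>
    rw [nablas, hF.left_bdry P σ h hP, holeFormula, Finset.range_zero, Finset.sum_empty,
      nablas_zero]
  | succ j ih =>
    have hτ := h.conj (tau P j)
    have := exchange (hF.isMultiaffineAt P σ h).2 (hF.isMultiaffineAt P _ hτ).2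
      (hF.continuity P σ h j hj) (hF.gluing P σ h j hj)
    rw [holeFormula_succ h hj, ← ih (by omega) hτ, nablas, pderiv_nablas,
      ← nablas_evalVar (by omega), this, nablas_add, nablas_evalVar le_rfl, ← pderiv_nablas,
      pderiv_evalVar_of_ne (by omega)]

/-- After the first `P` derivatives the polynomial is affine in the last position and vanishes at
one, so its slope is minus its value at zero. -/
theorem IsStationary.full {F : LoopFamily} (hF : IsStationary F) {P : ℕ} (hP : 1 ≤ P)
    {σ : Equiv.Perm (Fin (P + 1))} (h : IsLoop σ) :
    nablas (P + 1) (F (P + 1) σ) = -evalVar P 0 (nablas P (F (P + 1) σ)) := by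
  have ha := (hF.isMultiaffineAt (P + 1) σ h).2.nablas P P
  have h0 : evalVar P 1 (nablas P (F (P + 1) σ)) = 0 := by
    rw [← nablas_evalVar le_rfl]
    have := hF.right_bdry (P + 1) σ h (by omega)
    rw [Nat.add_sub_cancel] at this
    rw [this, nablas_zero]
  rw [eq_evalVar_add_of_pderiv_pderiv ha, map_add, map_mul, evalVar_X_self,
    evalVar_of_pderiv_eq_zero (pderiv_evalVar_self _ _ _), evalVar_of_pderiv_eq_zero ha, C_1,
    one_mul] at h0
  rw [nablas]
  linear_combination h0

theorem IsStationary.hasHoleFormula {F : LoopFamily} (hF : IsStationary F) :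
    HasHoleFormula F where
  multiaffine P _ := hF.isMultiaffineAt P
  one_point := hF.one_point
  hole P _ h j h1 hj := hF.hole (by omega) hj h
  full P _ h hP := hF.full hP h

/-! ### The explicit family -/

theorem pderiv_prod_X_of_le {n i : ℕ} (h : n ≤ i) :
    pderiv i (∏ t ∈ Finset.range n, (X t : Poly)) = 0 := by
  induction n with
  | zero => simp
  | succ n ih =>
    rw [Finset.prod_range_succ, pderiv_mul, ih (by omega), pderiv_X_of_ne (by omega)]
    simp

theorem isMultiaffine_prod_X (n : ℕ) : IsMultiaffine (∏ t ∈ Finset.range n, (X t : Poly)) := by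
  induction n with
  | zero => simpa using IsMultiaffine.one
  | succ n ih =>
    rw [Finset.prod_range_succ]
    refine ih.mul (IsMultiaffine.X n) fun i => ?_
    rcases le_or_gt n i with h | h
    · exact Or.inl (pderiv_prod_X_of_le h)
    · exact Or.inr (pderiv_X_of_ne (by omega))

theorem IsMultiaffine.prod_X_mul {n : ℕ} {f : Poly} (hf : IsMultiaffine f)
    (h : ∀ i, i < n → MvPolynomial.pderiv i f = 0) :
    IsMultiaffine ((∏ t ∈ Finset.range n, MvPolynomial.X t) * f) :=
  (isMultiaffine_prod_X n).mul hf fun i => by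
    rcases le_or_gt n i with h' | h'
    · exact Or.inl (pderiv_prod_X_of_le h')
    · exact Or.inr (h i h')

theorem nablas_prod_X_mul {n j : ℕ} (hj : j ≤ n) {f : Poly} (h : ∀ i, i < n → pderiv i f = 0) :
    nablas j ((∏ t ∈ Finset.range n, X t) * f) = (∏ t ∈ Finset.Ico j n, X t) * f := by
  induction j with
  | zero => rw [nablas, Finset.range_eq_Ico]
  | succ j ih =>
    have hp : pderiv j (∏ t ∈ Finset.Ico (j + 1) n, (X t : Poly)) = 0 := by
      refine pderiv_eq_zero_of_notMem_vars fun hm => ?_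
      obtain ⟨t, ht, hjt⟩ := Finset.mem_biUnion.1 (vars_prod _ hm)
      rw [vars_X, Finset.mem_singleton] at hjt
      have := (Finset.mem_Ico.1 ht).1
      omega
    rw [nablas, ih (by omega), Finset.prod_eq_prod_Ico_succ_bot (by omega), pderiv_mul,
      h j (by omega), pderiv_mul, hp, pderiv_X_self]
    simp

theorem evalVar_nablas_prod_X_mul {n j : ℕ} (hj : j < n) {f : Poly}
    (h : ∀ i, i < n → pderiv i f = 0) :
    evalVar j 0 (nablas j ((∏ t ∈ Finset.range n, X t) * f)) = 0 := by
  rw [nablas_prod_X_mul hj.le h, Finset.prod_eq_prod_Ico_succ_bot hj]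
  simp

theorem explicitLoop_one (a : ℝ) (σ : Equiv.Perm (Fin 1)) : explicitLoop a 1 σ = C a + X 0 := by
  rw [explicitLoop, if_pos rfl]

theorem explicitLoop_eq (a : ℝ) {P : ℕ} (hP : 1 ≤ P) {σ : Equiv.Perm (Fin (P + 1))}
    (h : IsLoop σ) :
    explicitLoop a (P + 1) σ
      = (∑ j ∈ Finset.Ico 1 P, (∏ i ∈ Finset.range j, X i) * holeFormula (explicitLoop a) σ j)
        + (∏ i ∈ Finset.range P, X i) * ((1 - X P) * holeFormula (explicitLoop a) σ P) := by
  have hG : ∀ j, j < P + 1 → holeFormula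
      (fun Q ρ => if _h : Q < P + 1 then explicitLoop a Q ρ else 0) σ j
        = holeFormula (explicitLoop a) σ j :=
    fun j hj => holeFormula_congr (fun Q hQ => by simp [hQ]) h hj
  have hsum : ∀ j ∈ Finset.Ico 1 P, (∏ i ∈ Finset.range j, (X i : Poly)) * holeFormula
      (fun Q ρ => if _h : Q < P + 1 then explicitLoop a Q ρ else 0) σ j
        = (∏ i ∈ Finset.range j, X i) * holeFormula (explicitLoop a) σ j :=
    fun j hj => by rw [hG j (by have := (Finset.mem_Ico.1 hj).2; omega)]
  rw [explicitLoop, if_neg (by omega)]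
  simp only [Nat.add_sub_cancel]
  rw [hG P (by omega), mul_assoc, Finset.sum_congr rfl hsum]

theorem pderiv_one_sub_X_mul {P i : ℕ} {f : Poly} (hi : i ≠ P) (h : pderiv i f = 0) :
    pderiv i ((1 - X P) * f) = 0 := by
  rw [pderiv_mul, map_sub, pderiv_one, pderiv_X_of_ne hi.symm, h]
  simp

theorem isMultiaffineAt_explicitLoop (a : ℝ) (P : ℕ) (hP : 0 < P) :
    IsMultiaffineAt (explicitLoop a) P := by
  induction P using Nat.strong_induction_on with
  | _ P ih =>
    obtain ⟨p, rfl⟩ : ∃ p, P = p + 1 := ⟨P - 1, by omega⟩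
    rcases Nat.eq_zero_or_pos p with rfl | hp
    · intro σ _
      rw [explicitLoop_one a σ]
      refine ⟨fun i hi => ?_, (IsMultiaffine.C a).add (IsMultiaffine.X 0)⟩
      rw [map_add, pderiv_C, pderiv_X_of_ne (by omega), add_zero]
    · intro σ hσ
      have hF : ∀ Q, 0 < Q → Q < p + 1 → IsMultiaffineAt (explicitLoop a) Q :=
        fun Q hQ hlt => ih Q hlt hQ
      rw [explicitLoop_eq a hp hσ]
      constructor
      · intro i hi
        rw [map_add, map_sum, pderiv_mul, pderiv_prod_X_of_le (by omega),
          pderiv_one_sub_X_mul (by omega) (pderiv_holeFormula_of_ge _ (by omega) hi),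
          Finset.sum_eq_zero]
        · simp
        · intro j hj
          have := (Finset.mem_Ico.1 hj).2
          rw [pderiv_mul, pderiv_prod_X_of_le (by omega),
            pderiv_holeFormula_of_ge _ (by omega) hi]
          simp
      · refine IsMultiaffine.add (IsMultiaffine.sum fun j hj => ?_) ?_
        · have := (Finset.mem_Ico.1 hj).2
          exact (isMultiaffine_holeFormula hF hσ (by omega)).prod_X_mul fun i hi =>
            pderiv_holeFormula_of_le hF hσ (by omega) hi.le
        · refine IsMultiaffine.prod_X_mul ?_ fun i hi =>
            pderiv_one_sub_X_mul (by omega) (pderiv_holeFormula_of_le hF hσ (by omega) hi.le)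
          refine (IsMultiaffine.one.sub (IsMultiaffine.X p)).mul
            (isMultiaffine_holeFormula hF hσ (by omega)) fun i => ?_
          rcases eq_or_ne p i with rfl | hi
          · exact Or.inr (pderiv_holeFormula_of_le hF hσ (by omega) le_rfl)
          · exact Or.inl (by rw [map_sub, pderiv_one, pderiv_X_of_ne hi, sub_zero])

theorem nablas_explicitLoop (a : ℝ) {P : ℕ} (hP : 1 ≤ P) {σ : Equiv.Perm (Fin (P + 1))}
    (h : IsLoop σ) :
    nablas P (explicitLoop a (P + 1) σ) = (1 - X P) * holeFormula (explicitLoop a) σ P := by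
  have hF : ∀ Q, 0 < Q → Q < P + 1 → IsMultiaffineAt (explicitLoop a) Q :=
    fun Q hQ _ => isMultiaffineAt_explicitLoop a Q hQ
  rw [explicitLoop_eq a hP h, nablas_add, nablas_sum, nablas_prod_X_mul le_rfl fun i hi =>
    pderiv_one_sub_X_mul (by omega) (pderiv_holeFormula_of_le hF h (by omega) hi.le),
    Finset.sum_eq_zero]
  · simp
  · intro j hj
    have := (Finset.mem_Ico.1 hj).2
    refine nablas_eq_zero this ?_
    rw [pderiv_mul, pderiv_prod_X_of_le le_rfl, pderiv_holeFormula_of_le hF h (by omega) le_rfl]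
    simp

/-- For `i < j` the derivative in position `i` kills the term, since neither factor contains `X i`.
For `i > j` a factor `X j` remains and is evaluated at zero. -/
theorem evalVar_holeTerm {F : LoopFamily} {P j : ℕ} (hF : ∀ Q, 0 < Q → Q < P → IsMultiaffineAt F Q)
    {σ : Equiv.Perm (Fin P)} (h : IsLoop σ) {i : ℕ} (hi : i < P) :
    evalVar j 0 (nablas j ((∏ t ∈ Finset.range i, X t) * holeFormula F σ i))
      = if i = j then holeFormula F σ j else 0 := by
  rcases lt_trichotomy i j with hij | rfl | hij
  · rw [if_neg hij.ne, nablas_eq_zero hij, map_zero]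
    rw [pderiv_mul, pderiv_prod_X_of_le le_rfl, pderiv_holeFormula_of_le hF h hi le_rfl]
    simp
  · rw [if_pos rfl, nablas_prod_X_mul le_rfl fun t ht => pderiv_holeFormula_of_le hF h hi ht.le,
      Finset.Ico_self, Finset.prod_empty, one_mul,
      evalVar_of_pderiv_eq_zero (pderiv_holeFormula_of_le hF h hi le_rfl)]
  · rw [if_neg hij.ne', evalVar_nablas_prod_X_mul hij fun t ht =>
      pderiv_holeFormula_of_le hF h hi ht.le]

theorem hasHoleFormula_explicitLoop (a : ℝ) : HasHoleFormula (explicitLoop a) where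
  multiaffine := isMultiaffineAt_explicitLoop a
  one_point := by
    rw [explicitLoop_one, map_add, pderiv_C, pderiv_X_self, zero_add]
  hole P σ h j h1 hj := by
    obtain ⟨p, rfl⟩ : ∃ p, P = p + 1 := ⟨P - 1, by omega⟩
    have hF : ∀ Q, 0 < Q → Q < p + 1 → IsMultiaffineAt (explicitLoop a) Q :=
      fun Q hQ _ => isMultiaffineAt_explicitLoop a Q hQ
    have hp : 1 ≤ p := by omega
    have hpp := pderiv_holeFormula_of_le hF h (j := p) (by omega) le_rfl
    rcases (Nat.lt_succ_iff.1 hj).eq_or_lt with rfl | hjp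
    · rw [nablas_explicitLoop a hp h, map_mul, evalVar_of_pderiv_eq_zero hpp]
      simp
    · rw [explicitLoop_eq a hp h, nablas_add, nablas_sum, map_add, map_sum,
        evalVar_nablas_prod_X_mul hjp fun i hi => pderiv_one_sub_X_mul (by omega)
          (pderiv_holeFormula_of_le hF h (by omega) hi.le), add_zero,
        Finset.sum_congr rfl fun i hi => evalVar_holeTerm hF h
          (by have := (Finset.mem_Ico.1 hi).2; omega),
        Finset.sum_ite_eq' , if_pos (Finset.mem_Ico.2 ⟨h1, hjp⟩)]
  full P σ h hP := by
    have hF : ∀ Q, 0 < Q → Q < P + 1 → IsMultiaffineAt (explicitLoop a) Q :=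
      fun Q hQ _ => isMultiaffineAt_explicitLoop a Q hQ
    have hpp := pderiv_holeFormula_of_le hF h (j := P) (by omega) le_rfl
    rw [nablas, nablas_explicitLoop a hP h, map_mul (evalVar P 0), evalVar_of_pderiv_eq_zero hpp,
      pderiv_mul, hpp]
    simp

/-! ### Holes in deformed regular loops -/

/-- Embedding of the labels of the regular loop cut off at the label `k`. -/
def minusEmb (k i : ℕ) : ℕ := if i = 0 then k else k + 1 + i

/-- Embedding of the labels of the loop that remains when `d` labels are cut off at `k`. -/
def plusEmb (k d i : ℕ) : ℕ := if i < k then i else if i = k then k + 1 else i + d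

theorem minusEmb_injective (k : ℕ) : Function.Injective (minusEmb k) := by
  intro i i' h
  unfold minusEmb at h
  split_ifs at h <;> omega

theorem plusEmb_injective (k : ℕ) {d : ℕ} (hd : 1 ≤ d) : Function.Injective (plusEmb k d) := by
  intro i i' h
  unfold plusEmb at h
  split_ifs at h <;> omega

/-- Both maps are extended to all of `ℕ` to be injective, and the extensions do overlap; hence the
side condition. -/
theorem minusEmb_ne_plusEmb {k d : ℕ} (hd : 1 ≤ d) {i i' : ℕ} (h : i < d ∨ i' ≤ k) :
    minusEmb k i ≠ plusEmb k d i' := by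
  unfold minusEmb plusEmb
  split_ifs <;> omega

section Cut

variable {F : LoopFamily} {m : ℕ} (μ : Equiv.Perm (Fin m)) {n p k d : ℕ}

theorem minusLoop_slide_deformedLoop (hF : HasHoleFormula F) (hd : 1 ≤ d) (hk : k < p)
    (hn : k < n - 1) (hm : n - 1 + m ≤ p) :
    minusLoop F (conj (slide (p + d) k (k + d)) (deformedLoop μ (n + d) (p + d))) k
      = rename (minusEmb k) (F d (finRotate d)) := by
  rw [minusLoop, tau_mul_conj_slide_deformedLoop μ (by omega) (by omega) (by omega) (by omega)]
  have hfix : ∀ x : Fin (p + d), (x : ℕ) ≤ k + d → deformation μ (n + d) (p + d) x = x :=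
    fun x hx => deformation_apply_of_lt μ (by omega) (by omega)
  have hlt : ∀ i, i < d → minusEmb k i ≤ k + d := fun i hi => by
    unfold minusEmb
    split_ifs <;> omega
  refine subLoop_eq_rename F (g := minusEmb k) (isLoop_finRotate d)
    (hF.multiaffine d hd _ (isLoop_finRotate d)).1 ?_ (fun i hi => (hlt i hi).trans_lt (by omega))
    ?_ (i₀ := 0) (by omega)
  · intro i i' h _
    unfold minusEmb
    split_ifs <;> omega
  · intro i hi
    have h1 := hfix ⟨minusEmb k i, (hlt i hi).trans_lt (by omega)⟩ (hlt i hi)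
    have h2 := hlt (finRotate d ⟨i, hi⟩ : Fin d) (Fin.is_lt _)
    rw [conj, Equiv.Perm.mul_apply, Equiv.Perm.mul_apply, Equiv.Perm.inv_eq_iff_eq.2 h1.symm,
      tau_mul_conj_slide_minus (by omega) (by omega)
        (y := ⟨minusEmb k (finRotate d ⟨i, hi⟩ : Fin d), by omega⟩), hfix _ h2]
    · unfold minusEmb
      dsimp only
      split_ifs <;> omega
    · have hfr := finRotate_val (⟨i, hi⟩ : Fin d)
      dsimp only at hfr ⊢
      have hv : ∀ t, minusEmb k t = if t = 0 then k else k + 1 + t := fun _ => rfl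
      have hvi := hv i
      have hvr := hv (finRotate d ⟨i, hi⟩ : Fin d)
      split_ifs at hfr <;> split_ifs at hvi <;> split_ifs at hvr <;> split_ifs <;> omega

theorem plusLoop_slide_deformedLoop (hF : HasHoleFormula F) (hd : 1 ≤ d) (hk : k < p)
    (hn : k < n - 1) (hm : n - 1 + m ≤ p) :
    plusLoop F (conj (slide (p + d) k (k + d)) (deformedLoop μ (n + d) (p + d))) k
      = rename (plusEmb k d) (F p (deformedLoop μ n p)) := by
  rw [plusLoop, tau_mul_conj_slide_deformedLoop μ (by omega) (by omega) (by omega) (by omega)]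
  have hlt : ∀ i, i < p → plusEmb k d i < p + d := fun i hi => by
    unfold plusEmb
    split_ifs <;> omega
  let e : Fin p → Fin (p + d) := fun i => ⟨plusEmb k d i, hlt i i.2⟩
  -- The support of the deformation lies beyond `k`, where the embedding is the shift by `d`; so the
  -- profile at `n + d` pulls back to the same profile at `n`.
  have hdef : ∀ i, deformation μ (n + d) (p + d) (e i) = e (deformation μ n p i) := by
    intro i
    rw [Fin.ext_iff, deformation_apply μ (by omega)]
    simp only [e]
    rw [deformation_apply μ hm]
    by_cases hi : n - 1 ≤ (i : ℕ)
    · have h1 : plusEmb k d i = i + d := by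
        unfold plusEmb
        split_ifs <;> omega
      simp only [h1]
      split_ifs with h2 h3 h3
      · have h4 : (i : ℕ) + d - (n + d - 1) = i - (n - 1) := by omega
        simp only [h4]
        have (t : ℕ) : plusEmb k d (n - 1 + t) = n - 1 + t + d := by
          rw [plusEmb, if_neg (by omega), if_neg (by omega)]
        rw [this]
        omega
      · omega
      · omega
      · rw [h1]
    · rw [dif_neg, dif_neg (by omega)]
      unfold plusEmb
      split_ifs <;> omega
  have hcut : ∀ i, (tau (p + d) k * conj (slide (p + d) k (k + d)) (finRotate (p + d))) (e i)
      = e (finRotate p i) := by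
    intro i
    have := i.2
    refine tau_mul_conj_slide_plus (by omega) (by omega) ?_ ?_
    · simp only [e]
      unfold plusEmb
      split_ifs <;> omega
    · simp only [e, finRotate_val]
      unfold plusEmb
      split_ifs <;> omega
  have hk0 : plusEmb k d k = k + 1 := by simp [plusEmb]
  have hloop := isLoop_deformedLoop μ n p
  have := subLoop_eq_rename F (g := plusEmb k d) hloop
    (hF.multiaffine p (by omega) _ hloop).1
    (π := conj (deformation μ (n + d) (p + d))
      (tau (p + d) k * conj (slide (p + d) k (k + d)) (finRotate (p + d)))) ?_ hlt ?_ hk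
  · rwa [hk0] at this
  · intro i i' h _
    unfold plusEmb
    split_ifs <;> omega
  · intro i hi
    have hinv : (deformation μ (n + d) (p + d))⁻¹ (e ⟨i, hi⟩)
        = e ((deformation μ n p)⁻¹ ⟨i, hi⟩) := by
      rw [Equiv.Perm.inv_eq_iff_eq, hdef, ← Equiv.Perm.mul_apply, mul_inv_cancel,
        Equiv.Perm.one_apply]
    change ((conj _ _) (e ⟨i, hi⟩) : ℕ) = _
    rw [conj, Equiv.Perm.mul_apply, Equiv.Perm.mul_apply, hinv, hcut, hdef]
    rfl

/-- The labels up to the hole `k + d` consist of all labels of the cut-off loop and the first `k +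
1` labels of the remaining one. -/
theorem perm_range_map (k : ℕ) {d : ℕ} (hd : 1 ≤ d) :
    (List.range (k + d + 1)).Perm
      ((List.range d).map (minusEmb k) ++ (List.range (k + 1)).map (plusEmb k d)) := by
  refine (List.perm_ext_iff_of_nodup List.nodup_range ?_).2 fun x => ?_
  · refine List.nodup_append.2 ⟨List.nodup_range.map (minusEmb_injective k),
      List.nodup_range.map (plusEmb_injective k hd), ?_⟩
    intro a ha b hb
    obtain ⟨i, hi, rfl⟩ := List.mem_map.1 ha
    obtain ⟨i', _, rfl⟩ := List.mem_map.1 hb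
    exact minusEmb_ne_plusEmb hd (Or.inl (List.mem_range.1 hi))
  · simp only [List.mem_append, List.mem_map, List.mem_range]
    constructor
    · intro hx
      by_cases h1 : x = k
      · exact Or.inl ⟨0, by omega, by simp [minusEmb, h1]⟩
      by_cases h2 : x < k
      · exact Or.inr ⟨x, by omega, by simp [plusEmb, h2]⟩
      by_cases h3 : x = k + 1
      · exact Or.inr ⟨k, by omega, by simp [plusEmb, h3]⟩
      · refine Or.inl ⟨x - (k + 1), by omega, ?_⟩
        unfold minusEmb
        split_ifs <;> omega
    · rintro (⟨i, hi, rfl⟩ | ⟨i, hi, rfl⟩)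
      · unfold minusEmb
        split_ifs <;> omega
      · unfold plusEmb
        split_ifs <;> omega

theorem nablas_rename_mul_rename (hd : 1 ≤ d) (f g : Poly) :
    nablas (k + d + 1) (rename (minusEmb k) f * rename (plusEmb k d) g)
      = rename (minusEmb k) (nablas d f) * rename (plusEmb k d) (nablas (k + 1) g) := by
  rw [← pderivs_range, pderivs_perm (perm_range_map k hd), pderivs_append_mul,
    pderivs_rename (minusEmb_injective k), pderivs_rename (plusEmb_injective k hd),
    pderivs_range, pderivs_range]
  · intro i hi
    obtain ⟨t, ht, rfl⟩ := List.mem_map.1 hi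
    exact pderiv_rename_eq_zero (fun s => minusEmb_ne_plusEmb hd
      (Or.inr (Nat.lt_succ_iff.1 (List.mem_range.1 ht)))) f
  · intro i hi
    obtain ⟨t, ht, rfl⟩ := List.mem_map.1 hi
    exact pderiv_rename_eq_zero (fun s => (minusEmb_ne_plusEmb hd
      (Or.inl (List.mem_range.1 ht))).symm) g

end Cut

/-- After differentiation in every position only a constant is left. -/
theorem rename_nablas_full {F : LoopFamily} (hF : HasHoleFormula F) {P : ℕ} (hP : 0 < P)
    {σ : Equiv.Perm (Fin P)} (h : IsLoop σ) (g : ℕ → ℕ) :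
    rename g (nablas P (F P σ)) = nablas P (F P σ) := by
  have h1 := hF.multiaffine P hP σ h
  rw [rename_congr (g' := id), rename_id_apply]
  intro i
  left
  rcases lt_or_ge i P with hi | hi
  · exact pderiv_nablas_of_lt h1.2 hi
  · rw [pderiv_nablas, h1.1 i hi, nablas_zero]

/-- Only labels beyond `k` survive the derivatives. They are shifted by `d` together with the number
of points, and floating variables do not see this. -/
theorem toFloating_rename_plusEmb {F : LoopFamily} (hF : HasHoleFormula F) {p k d : ℕ}
    (hp : 0 < p) {σ : Equiv.Perm (Fin p)} (h : IsLoop σ) :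
    toFloating (p + d) (rename (plusEmb k d) (nablas (k + 1) (F p σ)))
      = toFloating p (nablas (k + 1) (F p σ)) := by
  rw [toFloating, toFloating, rename_rename]
  refine rename_congr fun i => ?_
  rcases le_or_gt i k with hi | hi
  · exact Or.inl (pderiv_nablas_of_lt (hF.multiaffine p hp σ h).2 (by omega))
  · right
    simp only [Function.comp_apply, plusEmb]
    split_ifs <;> omega

/-- The full derivative of the regular loop with `n + 1` points. -/
def regularCoeff (F : LoopFamily) (n : ℕ) : Poly :=
  nablas (n + 1) (F (n + 1) (finRotate (n + 1)))

/-- The cut at `l` splits off `N - l + 1` points. The bound `q ≥ 2` puts the translate `q + l` to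
the right of that cut, and `q + m ≤ k + 2` keeps it inside the remaining chain of `l + k + 1`
points. -/
theorem toFloating_holeFormula_deformedLoop {F : LoopFamily} (hF : HasHoleFormula F) {m : ℕ}
    (μ : Equiv.Perm (Fin m)) {q k : ℕ} (hq : 2 ≤ q) (hk : q + m ≤ k + 2) (N : ℕ) :
    toFloating (N + k + 2) (holeFormula F (deformedLoop μ (q + N + 1) (N + k + 2)) (N + 1))
      = ∑ l ∈ Finset.range (N + 1), coeffC F μ (q + l) l k * regularCoeff F (N - l) := by
  rw [holeFormula, nablas_sum, map_sum]
  refine Finset.sum_congr rfl fun l hl => ?_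
  obtain ⟨d, rfl⟩ : ∃ d, N = l + d := ⟨N - l, by have := Finset.mem_range.1 hl; omega⟩
  have h1 : q + (l + d) + 1 = (q + l) + (d + 1) := by omega
  have h2 : l + d + k + 2 = (l + k + 1) + (d + 1) := by omega
  rw [h1, h2, show l + d + 1 = l + (d + 1) by omega,
    minusLoop_slide_deformedLoop μ hF (by omega) (by omega) (by omega) (by omega),
    plusLoop_slide_deformedLoop μ hF (by omega) (by omega) (by omega) (by omega),
    nablas_rename_mul_rename (by omega), map_mul,
    toFloating_rename_plusEmb hF (by omega) (isLoop_deformedLoop _ _ _),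
    rename_nablas_full hF (by omega) (isLoop_finRotate _), toFloating,
    rename_nablas_full hF (by omega) (isLoop_finRotate _), mul_comm, Nat.add_sub_cancel_left]
  rfl

/-! ### Catalan numbers from regular loops -/

theorem deformedLoop_of_isEmpty (μ : Equiv.Perm (Fin 0)) (n P : ℕ) :
    deformedLoop μ n P = finRotate P := by
  have : deformation μ n P = 1 := by
    by_cases h : n - 1 + 0 ≤ P
    · ext x
      rw [deformation_apply μ h, dif_neg (by omega)]
      rfl
    · exact dif_neg h
  simp [deformedLoop, this, conj]

theorem regularCoeff_succ {F : LoopFamily} (hF : HasHoleFormula F) (N : ℕ) :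
    regularCoeff F (N + 1)
      = -∑ l ∈ Finset.range (N + 1), regularCoeff F l * regularCoeff F (N - l) := by
  have h1 := hF.full (N + 1) _ (isLoop_finRotate (N + 2)) (by omega)
  rw [hF.hole (N + 2) _ (isLoop_finRotate (N + 2)) (N + 1) (by omega) (by omega)] at h1
  -- For the empty profile the position of the deformation is immaterial; `q = 2`, `k = 0` is the
  -- smallest admissible choice and puts the hole at the last label.
  have h2 := toFloating_holeFormula_deformedLoop hF (1 : Equiv.Perm (Fin 0)) (q := 2) (k := 0)
    le_rfl le_rfl N
  simp only [deformedLoop_of_isEmpty, coeffC, add_zero] at h2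
  rw [← neg_eq_iff_eq_neg.2 h1, map_neg, toFloating,
    rename_nablas_full hF (by omega) (isLoop_finRotate _)] at h2
  rw [regularCoeff, ← neg_eq_iff_eq_neg, h2]
  refine Finset.sum_congr rfl fun l _ => ?_
  rw [toFloating, rename_nablas_full hF (by omega) (isLoop_finRotate _)]
  rfl

theorem regularCoeff_eq {F : LoopFamily} (hF : HasHoleFormula F) (n : ℕ) :
    regularCoeff F n = (-1) ^ n * (catalan n : Poly) := by
  induction n using Nat.strong_induction_on with
  | _ n ih =>
    cases n with
    | zero =>
      have h : finRotate 1 = 1 := finRotate_one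
      rw [regularCoeff, zero_add, h]
      simpa [nablas] using hF.one_point
    | succ N =>
      rw [regularCoeff_succ hF, catalan_succ', Finset.Nat.sum_antidiagonal_eq_sum_range_succ
        (fun i j => catalan i * catalan j)]
      push_cast
      rw [Finset.mul_sum, ← Finset.sum_neg_distrib]
      refine Finset.sum_congr rfl fun l hl => ?_
      obtain ⟨d, rfl⟩ : ∃ d, N = l + d := ⟨N - l, by have := Finset.mem_range.1 hl; omega⟩
      rw [ih l (by omega), ih (l + d - l) (by omega), Nat.add_sub_cancel_left]
      ring

/-! ### Relations between the generating series -/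

/-- In a chain of `N + k + 2` points the label `N + 1` carries the floating variable `y_k`, in which
the differentiated polynomial is affine. -/
theorem coeffC_succ {F : LoopFamily} (hF : HasHoleFormula F) {m : ℕ} (μ : Equiv.Perm (Fin m))
    (n N k : ℕ) :
    coeffC F μ n N (k + 1) = coeffS F μ n N k + X k * coeffC F μ n (N + 1) k := by
  have h := (hF.multiaffine (N + k + 2) (by omega) _
    (isLoop_deformedLoop μ n (N + k + 2))).2.nablas (N + 1) (N + 1)
  have hX : toFloating (N + k + 2) (X (N + 1)) = X k := by
    rw [toFloating, rename_X]
    congr 1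
    omega
  have hP : N + 1 + k + 1 = N + k + 2 := by omega
  simp only [coeffC, coeffS]
  rw [hP, ← hX, ← map_mul, ← map_add]
  exact congrArg _ (eq_evalVar_add_of_pderiv_pderiv h)

theorem seriesD_succ {F : LoopFamily} (hF : HasHoleFormula F) {m : ℕ} (μ : Equiv.Perm (Fin m))
    {q : ℕ} (hq : 1 ≤ q) (k : ℕ) :
    seriesD F μ q (k + 1) = seriesS F μ (q - 1) k
      + PowerSeries.C (X k : Poly) * divZ (seriesD F μ (q - 1) k) := by
  ext1 N
  simp only [seriesD, seriesS, divZ, map_add, PowerSeries.coeff_C_mul, PowerSeries.coeff_mk]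
  rw [coeffC_succ hF, show q - 1 + N + 1 = q + N by omega, show q - 1 + (N + 1) = q + N by omega]

theorem seriesS_eq {F : LoopFamily} (hF : HasHoleFormula F) {m : ℕ} (μ : Equiv.Perm (Fin m))
    {q k : ℕ} (hq : 2 ≤ q) (hk : q + m ≤ k + 2) :
    seriesS F μ q k = altCatalan * seriesD F μ q k := by
  ext1 N
  rw [mul_comm, PowerSeries.coeff_mul]
  simp only [seriesD, seriesS, altCatalan, PowerSeries.coeff_mk]
  rw [Finset.Nat.sum_antidiagonal_eq_sum_range_succ
    (fun i j => coeffC F μ (q + i) i k * ((-1) ^ j * (catalan j : Poly))), coeffS,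
    hF.hole (N + k + 2) _ (isLoop_deformedLoop μ _ _) (N + 1) (by omega) (by omega),
    toFloating_holeFormula_deformedLoop hF μ hq hk]
  refine Finset.sum_congr rfl fun l _ => ?_
  rw [regularCoeff_eq hF]

theorem plusPart_eq (y : Poly) (f : PowerSeries Poly) :
    plusPart y f = altCatalan * f + PowerSeries.C y * divZ f := by
  ext1 N
  rw [plusPart, PowerSeries.coeff_mk, add_mul, ← map_mul, HahnSeries.coeff_add,
    HahnSeries.ofPowerSeries_apply_coeff, map_add, PowerSeries.coeff_C_mul, divZ,
    -- Degree `N` of the product with `y z⁻¹` comes from degree `N + 1` of `f`; the constant term of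
    -- `f` lands in degree `-1` and is dropped.
    PowerSeries.coeff_mk, show (N : ℤ) = ((N + 1 : ℕ) : ℤ) + (-1) by push_cast; ring,
    HahnSeries.coeff_single_mul_add, HahnSeries.ofPowerSeries_apply_coeff]

end QSSEP

end

theorem mainTheorem7
    (F : QSSEP.LoopFamily)
    (hF : QSSEP.IsStationary F ∨ ∃ a : ℝ, F = QSSEP.explicitLoop a)
    {m : ℕ} (μ : Equiv.Perm (Fin m)) :
    (∀ q k : ℕ, 2 ≤ q → q + m ≤ k + 3 →
      QSSEP.seriesD F μ q (k + 1)
        = QSSEP.seriesS F μ (q - 1) k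
          + PowerSeries.C (MvPolynomial.X k : QSSEP.Poly)
            * QSSEP.divZ (QSSEP.seriesD F μ (q - 1) k)) ∧
    (∀ q k : ℕ, 2 ≤ q → q + m ≤ k + 2 →
      QSSEP.seriesS F μ q k = QSSEP.altCatalan * QSSEP.seriesD F μ q k) ∧
    (∀ q k : ℕ, 3 ≤ q → q + m ≤ k + 3 →
      QSSEP.seriesD F μ q (k + 1)
        = QSSEP.plusPart (MvPolynomial.X k) (QSSEP.seriesD F μ (q - 1) k)) ∧
    (∀ (y : QSSEP.Poly) (A D S : PowerSeries QSSEP.Poly),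
      A = S + PowerSeries.C y * QSSEP.divZ D →
        (S = QSSEP.altCatalan * D ↔ A = QSSEP.plusPart y D)) := by
  have h : QSSEP.HasHoleFormula F := by
    rcases hF with hF | ⟨a, rfl⟩
    · exact hF.hasHoleFormula
    · exact QSSEP.hasHoleFormula_explicitLoop a
  refine ⟨fun q k hq _ => QSSEP.seriesD_succ h μ (by omega) k,
    fun q k hq hk => QSSEP.seriesS_eq h μ hq hk, fun q k hq hk => ?_, ?_⟩
  · rw [QSSEP.seriesD_succ h μ (by omega) k, QSSEP.seriesS_eq h μ (by omega) (by omega),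
      QSSEP.plusPart_eq]
  · rintro y A D S rfl
    rw [QSSEP.plusPart_eq]
    -- Both sides carry the same summand `y z⁻¹ (D - D(0))`, which cancels.
    exact (add_left_injective _).eq_iff.symm
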